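/- Let $\mathbb{D}=\{z\in\mathbb{C}:|z|<1\}$, let $m$ be Lebesgue area measure on $\mathbb{D}$ normalized so that $m(\mathbb{D})=1$, and let $\varphi_a(z)=(a-z)/(1-\overline{a}z)$ for $a,z\in\mathbb{D}$. The space BMOA consists of those functions $f$ analytic in $\mathbb{D}$ for which $\sup_{a\in\mathbb{D}}\|f_a\|_{H^2}^2<\infty$, where $f_a(z)=f(\varphi_a(z))-f(a)$ and $\|g\|_{H^2}^2=\sup_{0\le r<1}\frac1{2\pi}\int_0^{2\pi}|g(re^{i\theta})|^2\,d\theta$. Theorem. There exists an absolute constant $\varepsilon>0$ with the following property. If $A$ is analytic in $\mathbb{D}$ and $$\sup_{a\in\mathbb{D}}\left(\log\frac{e}{1-|a|}\right)^2\int_{\mathbb{D}}|A(z)|^2(1-|z|^2)^2\bigl(1-|\varphi_a(z)|^2\bigr)\,dm(z)\le\varepsilon,$$ then every analytic solution $f$ in $\mathbb{D}$ of the differential equation $f''+Af=0$ belongs to BMOA. -/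

import Mathlib

open MeasureTheory Metric
open scoped ENNReal

noncomputable section

/-- Lebesgue area measure on the unit disc `𝔻 = ball 0 1`, normalized so that `𝔻` has mass one. -/
def discMeasure : Measure ℂ :=
  (ENNReal.ofReal Real.pi)⁻¹ • (volume : Measure ℂ).restrict (ball (0 : ℂ) 1)

/-- The disc automorphism `φ_a(z) = (a - z) / (1 - conj a * z)`. -/
def discAut (a z : ℂ) : ℂ := (a - z) / (1 - (starRingEnd ℂ) a * z)

/-- The squared Hardy norm
`‖g‖²_{H²} = sup_{0 ≤ r < 1} (2π)⁻¹ ∫_0^{2π} |g(r e^{iθ})|² dθ`, with values in `[0, ∞]`. -/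
def hardyTwoNormSq (g : ℂ → ℂ) : ℝ≥0∞ :=
  ⨆ r ∈ Set.Ico (0 : ℝ) 1,
    (ENNReal.ofReal (2 * Real.pi))⁻¹ *
      ∫⁻ θ in Set.Ioc (0 : ℝ) (2 * Real.pi),
        ENNReal.ofReal (‖g ((r : ℂ) * Complex.exp ((θ : ℂ) * Complex.I))‖ ^ 2)

/-- `‖f‖²_BMOA = sup_{a ∈ 𝔻} ‖f_a‖²_{H²}`, where `f_a(z) = f(φ_a(z)) - f(a)`. -/
def bmoaNormSq (f : ℂ → ℂ) : ℝ≥0∞ :=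
  ⨆ a ∈ ball (0 : ℂ) 1, hardyTwoNormSq (fun z => f (discAut a z) - f a)

/-- The function `f` (only its values in `𝔻` matter) belongs to BMOA: it is analytic in `𝔻`
and `‖f‖_BMOA` is finite. -/
def MemBMOA (f : ℂ → ℂ) : Prop :=
  DifferentiableOn ℂ f (ball (0 : ℂ) 1) ∧ bmoaNormSq f < ∞

/-- The squared LMOA''-norm
`sup_{a ∈ 𝔻} (log (e / (1 - |a|)))² ∫_𝔻 |A(z)|² (1 - |z|²)² (1 - |φ_a(z)|²) dm(z)`,
with values in `[0, ∞]`. -/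
def lmoaSecondNormSq (A : ℂ → ℂ) : ℝ≥0∞ :=
  ⨆ a ∈ ball (0 : ℂ) 1,
    ENNReal.ofReal (Real.log (Real.exp 1 / (1 - ‖a‖)) ^ 2) *
      ∫⁻ z, ENNReal.ofReal
        (‖A z‖ ^ 2 * (1 - ‖z‖ ^ 2) ^ 2 * (1 - ‖discAut a z‖ ^ 2)) ∂discMeasure

end

/-!
The theorem is proved with superharmonic functions. An analytic function `f` has bounded mean
oscillation as soon as there is a *bounded* function `b` in the disc with `∂∂̄b ≤ -|f'|²`: then
`|f - f(a)|² + b` is superharmonic, since `∂∂̄|f - f(a)|² = |f'|²`, so is its composition with the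
automorphism `φ_a`, and the super-mean value inequality on circles about the origin gives
`mean |f ∘ φ_a - f(a)|² ≤ 2 sup |b|` (`memBMOA_of_hasDDbar_le`).

With `ρ(z) = 1 - |z|²`, such a function is `b = -4 ρ² |f'|² + L |f|² (V - N V²) - M |z|²`, where
`V(z) = ∫ |A(w)|² ρ(w)² (1 - |φ_z(w)|²) dm(w)` is the potential in the hypothesis
(`exists_bounded_hasDDbar_le`).

* The first term produces `-|f'|²` near the boundary, at the cost of `12 ρ² |f''|²`, which is
  `12 ρ² |A|² |f|²` by the equation (`exists_hasDDbar_weighted_normSq`).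
* The potential satisfies `-∂∂̄V(z) = ∫ |A(w)|² ρ(w)⁴ / |1 - w̄ z|⁴ dm(w)`
  (`exists_hasDDbar_potential`), which is at least a constant times `ρ² |A|²` by the sub-mean value
  property of `|A|²` (`sq_norm_mul_le_integral`). So `|f|² V` compensates the cost, up to the mixed
  term `2 Re (f' f̄ ∂̄V)`; this term is absorbed by the concave correction `-N V²`
  (`exists_hasDDbar_normSq_mul`).
* The last term takes care of a compact part of the disc.

For the boundedness of `b`, the hypothesis gives `V(z) log² (e / (1 - |z|)) ≤ ε`, and hence also
`|A(z)| (1 - |z|)² log (e / (1 - |z|)) ≤ 1 / 2`; integrating the equation along radii shows that `f`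
is a Bloch function, so that `ρ |f'|` is bounded and `|f(z)|` is `O(log (e / (1 - |z|)))`
(`exists_bloch_bound`). Therefore `|f|² V` is bounded.
-/

/-! ### Wirtinger derivatives -/

/-- The function `u` is real differentiable at `z` with Wirtinger derivatives
`∂u(z) = a` and `∂̄u(z) = b`. -/
def HasWirtingerAt (u : ℂ → ℂ) (a b z : ℂ) : Prop :=
  HasFDerivAt u (a • ContinuousLinearMap.id ℝ ℂ + b • (Complex.conjCLE : ℂ →L[ℝ] ℂ)) z

namespace HasWirtingerAt

variable {u v : ℂ → ℂ} {a b c d z : ℂ}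

lemma congr_coeff (h : HasWirtingerAt u a b z) (hc : a = c) (hd : b = d) :
    HasWirtingerAt u c d z := hc ▸ hd ▸ h

lemma of_hasDerivAt (h : HasDerivAt u a z) : HasWirtingerAt u a 0 z := by
  have := h.hasFDerivAt.restrictScalars ℝ
  refine this.congr_fderiv ?_
  ext; simp [mul_comm]

lemma add (hu : HasWirtingerAt u a b z) (hv : HasWirtingerAt v c d z) :
    HasWirtingerAt (fun z => u z + v z) (a + c) (b + d) z := by
  refine (HasFDerivAt.add hu hv).congr_fderiv ?_
  ext; simp; ring

lemma mul (hu : HasWirtingerAt u a b z) (hv : HasWirtingerAt v c d z) :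
    HasWirtingerAt (fun z => u z * v z) (u z * c + v z * a) (u z * d + v z * b) z := by
  refine (HasFDerivAt.mul hu hv).congr_fderiv ?_
  ext; simp; ring

lemma conj (hu : HasWirtingerAt u a b z) :
    HasWirtingerAt (fun z => (starRingEnd ℂ) (u z)) ((starRingEnd ℂ) b) ((starRingEnd ℂ) a) z := by
  refine ((Complex.conjCLE : ℂ →L[ℝ] ℂ).hasFDerivAt.comp z hu).congr_fderiv ?_
  ext; simp; ring

lemma comp_hasDerivAt {φ : ℂ → ℂ} {e : ℂ} (hu : HasWirtingerAt u a b (φ z))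
    (hφ : HasDerivAt φ e z) :
    HasWirtingerAt (fun z => u (φ z)) (a * e) (b * (starRingEnd ℂ) e) z := by
  refine (HasFDerivAt.comp z hu (hφ.hasFDerivAt.restrictScalars ℝ)).congr_fderiv ?_
  ext; simp; ring

/-- The derivative along a curve. -/
lemma comp_curve {γ : ℝ → ℂ} {e : ℂ} {t : ℝ} (hu : HasWirtingerAt u a b (γ t))
    (hγ : HasDerivAt γ e t) :
    HasDerivAt (fun t => u (γ t)) (a * e + b * (starRingEnd ℂ) e) t := by
  have := (HasFDerivAt.comp_hasDerivAt t hu hγ)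
  simpa using! this

lemma continuousAt (hu : HasWirtingerAt u a b z) : ContinuousAt u z :=
  HasFDerivAt.continuousAt hu

/-- Differentiation under the integral sign. -/
lemma integral {α : Type*} [MeasurableSpace α] {μ : Measure α} {F P Q : ℂ → α → ℂ}
    {s : Set ℂ} {bound : α → ℝ} (hs : s ∈ nhds z)
    (hF : ∀ z ∈ s, Integrable (F z) μ) (hP : Integrable (P z) μ) (hQ : Integrable (Q z) μ)
    (hb : Integrable bound μ) (hPQ : ∀ᵐ w ∂μ, ∀ z ∈ s, ‖P z w‖ + ‖Q z w‖ ≤ bound w)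
    (h : ∀ᵐ w ∂μ, ∀ z ∈ s, HasWirtingerAt (F · w) (P z w) (Q z w) z) :
    HasWirtingerAt (fun z => ∫ w, F z w ∂μ) (∫ w, P z w ∂μ) (∫ w, Q z w ∂μ) z := by
  have hP' : Integrable (fun w => P z w • ContinuousLinearMap.id ℝ ℂ) μ := hP.smul_const _
  have hQ' : Integrable (fun w => Q z w • (Complex.conjCLE : ℂ →L[ℝ] ℂ)) μ := hQ.smul_const _
  have key := hasFDerivAt_integral_of_dominated_of_fderiv_le (𝕜 := ℝ) (μ := μ) (F := F)
    (F' := fun z w => P z w • ContinuousLinearMap.id ℝ ℂ +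
      Q z w • (Complex.conjCLE : ℂ →L[ℝ] ℂ)) (x₀ := z) (bound := bound) hs
    (Filter.mem_of_superset hs fun y hy => (hF y hy).aestronglyMeasurable)
    (hF z (mem_of_mem_nhds hs)) (hP'.aestronglyMeasurable.add hQ'.aestronglyMeasurable)
    (by
      filter_upwards [hPQ] with w hw y hy
      refine (norm_add_le _ _).trans (le_trans ?_ (hw y hy))
      rw [norm_smul, norm_smul]
      gcongr
      · exact mul_le_of_le_one_right (norm_nonneg _) ContinuousLinearMap.norm_id_le
      · exact mul_le_of_le_one_right (norm_nonneg _) (by simp)) hb h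
  refine key.congr_fderiv ?_
  rw [integral_add hP' hQ', integral_smul_const, integral_smul_const]

end HasWirtingerAt

/-- The real function `u` is of class `C²` in the unit disc, with `∂u = p` and `∂∂̄u = q`.
In terms of the Laplacian, `4 q = Δu`. The existentially quantified `s` is `∂²u`; its continuity and
that of `q` make `u` twice continuously differentiable. -/
def HasDDbar (u : ℂ → ℝ) (p : ℂ → ℂ) (q : ℂ → ℝ) : Prop :=
  ∃ s : ℂ → ℂ, ContinuousOn s (ball 0 1) ∧ ContinuousOn q (ball 0 1) ∧ ∀ z ∈ ball (0 : ℂ) 1,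
    HasWirtingerAt (fun z => (u z : ℂ)) (p z) ((starRingEnd ℂ) (p z)) z ∧
    HasWirtingerAt p (s z) (q z) z

namespace HasDDbar

variable {u v : ℂ → ℝ} {p p₁ p₂ : ℂ → ℂ} {q q₁ q₂ : ℂ → ℝ}

lemma continuousOn (h : HasDDbar u p q) : ContinuousOn u (ball 0 1) := by
  obtain ⟨s, -, -, h⟩ := h
  intro z hz
  have := (h z hz).1.continuousAt
  exact (Complex.continuous_re.continuousAt.comp this).continuousWithinAt

lemma continuousOn_fst (h : HasDDbar u p q) : ContinuousOn p (ball 0 1) := by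
  obtain ⟨s, -, -, h⟩ := h
  exact fun z hz => (h z hz).2.continuousAt.continuousWithinAt

lemma congr_coeff (h : HasDDbar u p₁ q₁) (hp : p₁ = p₂) (hq : q₁ = q₂) : HasDDbar u p₂ q₂ :=
  hp ▸ hq ▸ h

lemma add (hu : HasDDbar u p₁ q₁) (hv : HasDDbar v p₂ q₂) :
    HasDDbar (fun z => u z + v z) (fun z => p₁ z + p₂ z) (fun z => q₁ z + q₂ z) := by
  obtain ⟨s₁, hs₁, hq₁, h₁⟩ := hu
  obtain ⟨s₂, hs₂, hq₂, h₂⟩ := hv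
  refine ⟨fun z => s₁ z + s₂ z, hs₁.add hs₂, hq₁.add hq₂, fun z hz => ⟨?_, ?_⟩⟩
  · simpa using (h₁ z hz).1.add (h₂ z hz).1
  · simpa using (h₁ z hz).2.add (h₂ z hz).2

lemma mul (hu : HasDDbar u p₁ q₁) (hv : HasDDbar v p₂ q₂) :
    HasDDbar (fun z => u z * v z) (fun z => u z * p₂ z + v z * p₁ z)
      (fun z => u z * q₂ z + v z * q₁ z + 2 * (p₁ z * (starRingEnd ℂ) (p₂ z)).re) := by
  have cu := hu.continuousOn
  have cv := hv.continuousOn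
  have cp₁ := hu.continuousOn_fst
  have cp₂ := hv.continuousOn_fst
  obtain ⟨s₁, hs₁, hq₁, h₁⟩ := hu
  obtain ⟨s₂, hs₂, hq₂, h₂⟩ := hv
  refine ⟨fun z => u z * s₂ z + v z * s₁ z + 2 * (p₁ z * p₂ z), ?_, ?_, fun z hz => ⟨?_, ?_⟩⟩
  · fun_prop
  · refine ((cu.mul hq₂).add (cv.mul hq₁)).add (continuousOn_const.mul ?_)
    exact Complex.continuous_re.comp_continuousOn
      (cp₁.mul (Complex.continuous_conj.comp_continuousOn cp₂))
  · simpa using (h₁ z hz).1.mul (h₂ z hz).1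
  · refine (((h₁ z hz).1.mul (h₂ z hz).2).add ((h₂ z hz).1.mul (h₁ z hz).2)).congr_coeff ?_ ?_
    · ring
    · have := Complex.add_conj (p₁ z * (starRingEnd ℂ) (p₂ z))
      simp only [map_mul, Complex.conj_conj] at this
      push_cast at this ⊢
      rw [← this]
      ring

lemma const (c : ℝ) : HasDDbar (fun _ => c) (fun _ => 0) (fun _ => 0) := by
  refine ⟨fun _ => 0, continuousOn_const, continuousOn_const, fun z _ => ⟨?_, ?_⟩⟩
  · simpa using HasWirtingerAt.of_hasDerivAt (hasDerivAt_const z (c : ℂ))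
  · simpa using HasWirtingerAt.of_hasDerivAt (hasDerivAt_const z (0 : ℂ))

lemma const_mul (c : ℝ) (hu : HasDDbar u p q) :
    HasDDbar (fun z => c * u z) (fun z => c * p z) (fun z => c * q z) := by
  refine ((const c).mul hu).congr_coeff ?_ ?_ <;> ext z <;> simp

/-- `∂∂̄|g|² = |g'|²` for a holomorphic function `g`. -/
lemma normSq {g : ℂ → ℂ} (hg : DifferentiableOn ℂ g (ball 0 1)) :
    HasDDbar (fun z => ‖g z‖ ^ 2) (fun z => deriv g z * (starRingEnd ℂ) (g z))
      (fun z => ‖deriv g z‖ ^ 2) := by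
  have hg' : DifferentiableOn ℂ (deriv g) (ball 0 1) := hg.deriv isOpen_ball
  have hg'' : DifferentiableOn ℂ (deriv (deriv g)) (ball 0 1) := hg'.deriv isOpen_ball
  refine ⟨fun z => deriv (deriv g) z * (starRingEnd ℂ) (g z), ?_, ?_, fun z hz => ?_⟩
  · exact hg''.continuousOn.mul (Complex.continuous_conj.comp_continuousOn hg.continuousOn)
  · exact hg'.continuousOn.norm.pow 2
  have h1 := HasWirtingerAt.of_hasDerivAt
    ((hg.differentiableAt (isOpen_ball.mem_nhds hz)).hasDerivAt)
  have h2 := HasWirtingerAt.of_hasDerivAt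
    ((hg'.differentiableAt (isOpen_ball.mem_nhds hz)).hasDerivAt)
  constructor
  · have := h1.mul h1.conj
    simp only [Complex.mul_conj, Complex.normSq_eq_norm_sq] at this
    refine this.congr_coeff ?_ ?_ <;> simp <;> ring
  · refine (h2.mul h1.conj).congr_coeff ?_ ?_
    · simp; ring
    · simp [Complex.mul_conj, Complex.normSq_eq_norm_sq]

lemma comp {φ : ℂ → ℂ} (hu : HasDDbar u p q) (hφ : DifferentiableOn ℂ φ (ball 0 1))
    (hm : Set.MapsTo φ (ball 0 1) (ball 0 1)) :
    HasDDbar (fun z => u (φ z)) (fun z => p (φ z) * deriv φ z)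
      (fun z => q (φ z) * ‖deriv φ z‖ ^ 2) := by
  have cp := hu.continuousOn_fst
  obtain ⟨s, hs, hq, h⟩ := hu
  have hφ' : DifferentiableOn ℂ (deriv φ) (ball 0 1) := hφ.deriv isOpen_ball
  have hφ'' : DifferentiableOn ℂ (deriv (deriv φ)) (ball 0 1) := hφ'.deriv isOpen_ball
  have c0 := hφ.continuousOn
  have c1 := hφ'.continuousOn
  have c2 := hφ''.continuousOn
  refine ⟨fun z => s (φ z) * deriv φ z * deriv φ z + p (φ z) * deriv (deriv φ) z, ?_, ?_,
    fun z hz => ?_⟩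
  · exact (((hs.comp c0 hm).mul c1).mul c1).add ((cp.comp c0 hm).mul c2)
  · exact (hq.comp c0 hm).mul (c1.norm.pow 2)
  have h1 := (hφ.differentiableAt (isOpen_ball.mem_nhds hz)).hasDerivAt
  have h2 := (hφ'.differentiableAt (isOpen_ball.mem_nhds hz)).hasDerivAt
  constructor
  · refine ((h _ (hm hz)).1.comp_hasDerivAt h1).congr_coeff rfl ?_
    simp
  · refine (((h _ (hm hz)).2.comp_hasDerivAt h1).mul (.of_hasDerivAt h2)).congr_coeff ?_ ?_
    · ring
    · push_cast
      rw [← Complex.conj_mul']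
      ring

end HasDDbar

/-! ### The mean value inequality -/

lemma hasDerivAt_intervalIntegral_of_continuousOn {F F' : ℝ → ℝ → ℝ} {U : Set ℝ} (hU : IsOpen U)
    {a b x₀ : ℝ} (hx₀ : x₀ ∈ U) (hF : ∀ x ∈ U, Continuous (F x))
    (hF' : ContinuousOn (Function.uncurry F') (U ×ˢ Set.univ))
    (hd : ∀ x ∈ U, ∀ t, HasDerivAt (F · t) (F' x t) x) :
    HasDerivAt (fun x => ∫ t in a..b, F x t) (∫ t in a..b, F' x₀ t) x₀ := by
  obtain ⟨δ, hδ, hsub⟩ := Metric.isOpen_iff.1 hU x₀ hx₀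
  have hsub' : closedBall x₀ (δ / 2) ⊆ U :=
    (closedBall_subset_ball (half_lt_self hδ)).trans hsub
  have hK : IsCompact (closedBall x₀ (δ / 2) ×ˢ Set.uIcc a b) :=
    (isCompact_closedBall _ _).prod isCompact_uIcc
  obtain ⟨C, hC⟩ := hK.exists_bound_of_continuousOn
    (hF'.mono (Set.prod_mono hsub' (Set.subset_univ _)))
  have hcont : Continuous (F' x₀) := by
    rw [← continuousOn_univ]
    exact hF'.comp (f := fun t => (x₀, t)) (by fun_prop) (fun t _ => ⟨hx₀, trivial⟩)
  refine (intervalIntegral.hasDerivAt_integral_of_dominated_loc_of_deriv_le (F := F) (F' := F')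
    (bound := fun _ => C) (closedBall_mem_nhds x₀ (half_pos hδ)) ?_ ?_ ?_ ?_ ?_ ?_).2
  · filter_upwards [hU.mem_nhds hx₀] with x hx
    exact (hF x hx).aestronglyMeasurable
  · exact (hF x₀ hx₀).intervalIntegrable _ _
  · exact hcont.aestronglyMeasurable
  · exact .of_forall fun t ht x hx => hC (x, t) ⟨hx, Set.uIoc_subset_uIcc ht⟩
  · exact intervalIntegrable_const
  · exact .of_forall fun t _ x hx => hd x (hsub' hx) t

/-- A `C²` function with `Δu ≤ 0` in the disc satisfies the super-mean value inequality on circles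
about the origin: the mean `m(r)` satisfies `(r m'(r))' = r · mean(Δu) ≤ 0`. -/
lemma HasDDbar.integral_circle_le {u : ℂ → ℝ} {p : ℂ → ℂ} {q : ℂ → ℝ} (h : HasDDbar u p q)
    (hq : ∀ z ∈ ball (0 : ℂ) 1, q z ≤ 0) {r : ℝ} (hr0 : 0 ≤ r) (hr1 : r < 1) :
    ∫ θ in (0 : ℝ)..2 * Real.pi, u (circleMap 0 r θ) ≤ 2 * Real.pi * u 0 := by
  have cu := h.continuousOn
  have cp := h.continuousOn_fst
  obtain ⟨s, hs, cq, hd⟩ := h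
  set U : Set ℝ := Set.Ioo (-1) 1 with hUdef
  have hU : IsOpen U := isOpen_Ioo
  have hmem : ∀ x ∈ U, ∀ t, circleMap 0 x t ∈ ball (0 : ℂ) 1 := by
    intro x hx t
    simpa [abs_lt, hUdef] using hx
  set e : ℝ → ℂ := fun t => Complex.exp (t * Complex.I) with he
  have hcm : ∀ x t, circleMap 0 x t = x * e t := fun x t => by simp [circleMap, he]
  have hee : ∀ t, e t * (starRingEnd ℂ) (e t) = 1 := fun t => by
    rw [Complex.mul_conj, Complex.normSq_eq_norm_sq, he]
    simp [Complex.norm_exp_ofReal_mul_I]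
  have de : ∀ t, HasDerivAt e (e t * Complex.I) t := fun t => by
    have h1 : HasDerivAt (fun t : ℝ => (t : ℂ) * Complex.I) (1 * Complex.I) t :=
      (Complex.ofRealCLM.hasDerivAt (x := t)).mul_const _
    simpa using h1.cexp
  have ce : Continuous e := by fun_prop
  -- the two curves through a point: radial and circular
  have dr : ∀ x t, HasDerivAt (fun x => circleMap 0 x t) (e t) x := fun x t => by
    simp only [hcm]
    simpa using (Complex.ofRealCLM.hasDerivAt (x := x)).mul_const (e t)
  have dθ : ∀ x t, HasDerivAt (fun t => circleMap 0 x t) (x * (e t * Complex.I)) t := fun x t => by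
    simp only [hcm]
    exact (de t).const_mul _
  have cmap : Continuous (fun y : ℝ × ℝ => circleMap 0 y.1 y.2) := by
    simp only [hcm]; fun_prop
  have hmaps : Set.MapsTo (fun y : ℝ × ℝ => circleMap 0 y.1 y.2) (U ×ˢ Set.univ) (ball 0 1) :=
    fun y hy => hmem _ hy.1 _
  have cpU := cp.comp cmap.continuousOn hmaps
  have csU := hs.comp cmap.continuousOn hmaps
  have cqU := cq.comp cmap.continuousOn hmaps
  have slice : ∀ x ∈ U, Continuous (fun t => circleMap 0 x t) := fun x _ => by fun_prop
  -- the derivative of the circular mean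
  have dG : ∀ x ∈ U, HasDerivAt (fun x => ∫ t in (0 : ℝ)..2 * Real.pi, u (circleMap 0 x t))
      (∫ t in (0 : ℝ)..2 * Real.pi, 2 * (p (circleMap 0 x t) * e t).re) x := by
    intro x hx
    refine hasDerivAt_intervalIntegral_of_continuousOn hU hx
      (F' := fun x t => 2 * (p (circleMap 0 x t) * e t).re) ?_ ?_ ?_
    · exact fun x hx => cu.comp_continuous (slice x hx) (hmem x hx)
    · refine continuousOn_const.mul (Complex.continuous_re.comp_continuousOn ?_)
      exact cpU.mul (by fun_prop)
    · intro x hx t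
      have h1 := (hd _ (hmem x hx t)).1.comp_curve
        (γ := fun x => circleMap 0 x t) (dr x t)
      have h2 := Complex.reCLM.hasFDerivAt.comp_hasDerivAt x h1
      refine h2.congr_deriv ?_
      simp
      ring
  -- the derivative of `r` times the derivative of the circular mean
  have dH : ∀ x ∈ U, HasDerivAt
      (fun x => ∫ t in (0 : ℝ)..2 * Real.pi, x * (2 * (p (circleMap 0 x t) * e t).re))
      (∫ t in (0 : ℝ)..2 * Real.pi, 4 * x * q (circleMap 0 x t)) x := by
    intro x hx
    have key := hasDerivAt_intervalIntegral_of_continuousOn hU hx (a := 0) (b := 2 * Real.pi)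
      (F := fun x t => x * (2 * (p (circleMap 0 x t) * e t).re))
      (F' := fun x t => 2 * (p (circleMap 0 x t) * e t).re +
        x * (2 * ((s (circleMap 0 x t) * e t + q (circleMap 0 x t) * (starRingEnd ℂ) (e t))
          * e t).re)) ?_ ?_ ?_
    · convert key using 1
      -- the derivative with respect to the angle integrates to zero
      have hθ : ∀ t ∈ Set.uIcc (0 : ℝ) (2 * Real.pi), HasDerivAt
          (fun t => 2 * (p (circleMap 0 x t) * e t).im)
          (2 * (p (circleMap 0 x t) * e t).re +
            x * (2 * ((s (circleMap 0 x t) * e t - q (circleMap 0 x t) * (starRingEnd ℂ) (e t))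
              * e t).re)) t := by
        intro t _
        have h1 := ((hd _ (hmem x hx t)).2.comp_curve (dθ x t)).mul (de t)
        have h2 := (Complex.imCLM.hasFDerivAt.comp_hasDerivAt t h1).const_mul 2
        refine h2.congr_deriv ?_
        simp
        ring
      have cθ : Continuous (fun t => 2 * (p (circleMap 0 x t) * e t).re +
            x * (2 * ((s (circleMap 0 x t) * e t - q (circleMap 0 x t) * (starRingEnd ℂ) (e t))
              * e t).re)) := by
        have c1 := cp.comp_continuous (slice x hx) (hmem x hx)
        have c2 := hs.comp_continuous (slice x hx) (hmem x hx)
        have c3 := cq.comp_continuous (slice x hx) (hmem x hx)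
        have c4 : Continuous fun t => (starRingEnd ℂ) (e t) := Complex.continuous_conj.comp ce
        have c5 : Continuous fun t => (q (circleMap 0 x t) : ℂ) :=
          Complex.continuous_ofReal.comp c3
        exact (continuous_const.mul (Complex.continuous_re.comp (c1.mul ce))).add
          (continuous_const.mul (continuous_const.mul (Complex.continuous_re.comp
            (((c2.mul ce).sub (c5.mul c4)).mul ce))))
      have hint := intervalIntegral.integral_eq_sub_of_hasDerivAt hθ (cθ.intervalIntegrable _ _)
      have hper : 2 * (p (circleMap 0 x (2 * Real.pi)) * e (2 * Real.pi)).im =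
          2 * (p (circleMap 0 x 0) * e 0).im := by
        have : e (2 * Real.pi) = e 0 := by simp [he]
        simp only [hcm, this]
      have hqi : IntervalIntegrable (fun t => 4 * x * q (circleMap 0 x t)) volume 0
          (2 * Real.pi) :=
        (continuous_const.mul (cq.comp_continuous (slice x hx) (hmem x hx))).intervalIntegrable _ _
      rw [hper, sub_self] at hint
      have hadd := intervalIntegral.integral_add hqi (cθ.intervalIntegrable _ _)
      rw [hint, add_zero] at hadd
      rw [← hadd]
      refine intervalIntegral.integral_congr fun t _ => ?_
      have e1 : (q (circleMap 0 x t) : ℂ) * (starRingEnd ℂ) (e t) * e t = q (circleMap 0 x t) := by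
        rw [mul_assoc, mul_comm _ (e t), hee, mul_one]
      simp only [add_mul, sub_mul, e1, Complex.add_re, Complex.sub_re, Complex.ofReal_re]
      ring
    · intro x hx
      exact continuous_const.mul (continuous_const.mul (Complex.continuous_re.comp
        ((cp.comp_continuous (slice x hx) (hmem x hx)).mul ce)))
    · have c4 : Continuous fun t => (starRingEnd ℂ) (e t) := Complex.continuous_conj.comp ce
      have ce2 : ContinuousOn (fun y : ℝ × ℝ => e y.2) (U ×ˢ Set.univ) := by fun_prop
      have c42 : ContinuousOn (fun y : ℝ × ℝ => (starRingEnd ℂ) (e y.2)) (U ×ˢ Set.univ) := by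
        fun_prop
      have cqU' := Complex.continuous_ofReal.comp_continuousOn cqU
      refine (continuousOn_const.mul (Complex.continuous_re.comp_continuousOn
        (cpU.mul ce2))).add (continuous_fst.continuousOn.mul (continuousOn_const.mul
          (Complex.continuous_re.comp_continuousOn ?_)))
      exact ((csU.mul ce2).add (cqU'.mul c42)).mul ce2
    · intro x hx t
      have h1 := ((hd _ (hmem x hx t)).2.comp_curve
        (γ := fun x => circleMap 0 x t) (dr x t)).mul_const (e t)
      have h2 := (Complex.reCLM.hasFDerivAt.comp_hasDerivAt x h1).const_mul 2
      have h3 := (hasDerivAt_id x).mul h2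
      refine h3.congr_deriv ?_
      simp
  have hsubU : Set.Ico (0 : ℝ) 1 ⊆ U := fun x hx => ⟨by linarith [hx.1], hx.2⟩
  have hint : interior (Set.Ico (0 : ℝ) 1) = Set.Ioo 0 1 := interior_Ico
  have pi_nn : (0 : ℝ) ≤ 2 * Real.pi := by positivity
  have antiH : AntitoneOn
      (fun x => ∫ t in (0 : ℝ)..2 * Real.pi, x * (2 * (p (circleMap 0 x t) * e t).re))
      (Set.Ico 0 1) := by
    refine antitoneOn_of_deriv_nonpos (convex_Ico 0 1)
      (fun x hx => (dH x (hsubU hx)).continuousAt.continuousWithinAt)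
      (fun x hx => (dH x (hsubU (interior_subset hx))).differentiableAt.differentiableWithinAt) ?_
    intro x hx
    have hx' := interior_subset hx
    rw [(dH x (hsubU hx')).deriv]
    have : ∫ t in (0 : ℝ)..2 * Real.pi, 4 * x * q (circleMap 0 x t) ≤
        ∫ t in (0 : ℝ)..2 * Real.pi, (0 : ℝ) :=
      intervalIntegral.integral_mono_on pi_nn
        ((continuous_const.mul (cq.comp_continuous (slice x (hsubU hx'))
          (hmem x (hsubU hx')))).intervalIntegrable _ _) intervalIntegrable_const
        fun t _ => mul_nonpos_of_nonneg_of_nonpos (by linarith [hx'.1])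
          (hq _ (hmem x (hsubU hx') t))
    simpa using this
  have antiG : AntitoneOn (fun x => ∫ t in (0 : ℝ)..2 * Real.pi, u (circleMap 0 x t))
      (Set.Ico 0 1) := by
    refine antitoneOn_of_deriv_nonpos (convex_Ico 0 1)
      (fun x hx => (dG x (hsubU hx)).continuousAt.continuousWithinAt)
      (fun x hx => (dG x (hsubU (interior_subset hx))).differentiableAt.differentiableWithinAt) ?_
    intro x hx
    rw [hint] at hx
    rw [(dG x (hsubU ⟨hx.1.le, hx.2⟩)).deriv]
    have := antiH ⟨le_rfl, one_pos⟩ ⟨hx.1.le, hx.2⟩ hx.1.le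
    simp only [zero_mul, intervalIntegral.integral_zero,
      intervalIntegral.integral_const_mul x] at this
    exact nonpos_of_mul_nonpos_right this hx.1
  have := antiG ⟨le_rfl, one_pos⟩ ⟨hr0, hr1⟩ hr0
  simpa using this

/-! ### The area measure of the disc -/

lemma ae_discMeasure_mem_ball : ∀ᵐ w ∂discMeasure, w ∈ ball (0 : ℂ) 1 :=
  Measure.ae_smul_measure (ae_restrict_mem measurableSet_ball) _

lemma integral_discMeasure (h : ℂ → ℝ) :
    ∫ w, h w ∂discMeasure = Real.pi⁻¹ * ∫ w in ball (0 : ℂ) 1, h w := by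
  rw [discMeasure, integral_smul_measure, ENNReal.toReal_inv,
    ENNReal.toReal_ofReal Real.pi_pos.le, smul_eq_mul]

lemma integrable_discMeasure_iff {h : ℂ → ℝ} :
    Integrable h discMeasure ↔ IntegrableOn h (ball (0 : ℂ) 1) :=
  integrable_smul_measure (by simp) (by simp [Real.pi_pos])

lemma ContinuousOn.aestronglyMeasurable_discMeasure {h : ℂ → ℝ}
    (hh : ContinuousOn h (ball 0 1)) : AEStronglyMeasurable h discMeasure :=
  (hh.aestronglyMeasurable measurableSet_ball).smul_measure _

/-- The mean of a holomorphic function over a disc vanishes if its value at the centre does. -/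
lemma integral_ball_eq_zero {g : ℂ → ℂ} {c : ℂ} {R : ℝ}
    (hg : DifferentiableOn ℂ g (ball c R)) (hc : g c = 0) : ∫ w in ball c R, g w = 0 := by
  have h1 : ∫ w in ball c R, g w = ∫ w, (ball (0 : ℂ) R).indicator (fun w => g (c + w)) w := by
    rw [← integral_indicator measurableSet_ball,
      ← integral_add_left_eq_self (μ := volume) ((ball c R).indicator g) c]
    congr 1 with w
    simp [Set.indicator, mem_ball, dist_eq_norm]
  rw [h1, ← Complex.integral_comp_polarCoord_symm, polarCoord_target, Measure.volume_eq_prod,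
    ← Measure.prod_restrict]
  by_cases hi : Integrable (fun p : ℝ × ℝ => p.1 •
      (ball (0 : ℂ) R).indicator (fun w => g (c + w)) (Complex.polarCoord.symm p))
      ((volume.restrict (Set.Ioi (0 : ℝ))).prod (volume.restrict (Set.Ioo (-Real.pi) Real.pi)))
  swap
  · exact integral_undef hi
  rw [integral_prod _ hi]
  refine setIntegral_eq_zero_of_forall_eq_zero fun r (hr : 0 < r) => ?_
  by_cases hrR : r < R
  swap
  · refine integral_eq_zero_of_ae (.of_forall fun θ => ?_)
    have : Complex.polarCoord.symm (r, θ) ∉ ball (0 : ℂ) R := by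
      rw [mem_ball_zero_iff, Complex.norm_polarCoord_symm, abs_of_pos hr]
      exact hrR
    change r • (ball (0 : ℂ) R).indicator (fun w => g (c + w)) (Complex.polarCoord.symm (r, θ)) = 0
    rw [Set.indicator_of_notMem this, smul_zero]
  have hsub : closedBall c |r| ⊆ ball c R := by
    rw [abs_of_pos hr]; exact closedBall_subset_ball hrR
  have h2 : Real.circleAverage g c r = g c :=
    DiffContOnCl.circleAverage ((hg.mono hsub).diffContOnCl_ball le_rfl)
  have h3 : ∀ θ, (ball (0 : ℂ) R).indicator (fun w => g (c + w)) (Complex.polarCoord.symm (r, θ))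
      = g (circleMap c r θ) := by
    intro θ
    have : Complex.polarCoord.symm (r, θ) ∈ ball (0 : ℂ) R := by
      rw [mem_ball_zero_iff, Complex.norm_polarCoord_symm, abs_of_pos hr]
      exact hrR
    rw [Set.indicator_of_mem this, Complex.polarCoord_symm_apply, circleMap, Complex.exp_mul_I]
    simp
  have h4 : ∫ θ in (0 : ℝ)..2 * Real.pi, g (circleMap c r θ) = 0 := by
    rw [Real.circleAverage_def, hc] at h2
    exact (smul_eq_zero.1 h2).resolve_left (by positivity)
  have hper : Function.Periodic (fun θ => g (circleMap c r θ)) (2 * Real.pi) := fun θ => by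
    simp only [periodic_circleMap c r θ]
  have h5 := hper.intervalIntegral_add_eq 0 (-Real.pi)
  rw [zero_add, h4] at h5
  rw [integral_smul]
  simp_rw [h3]
  rw [← integral_Ioc_eq_integral_Ioo, ← intervalIntegral.integral_of_le
    (by linarith [Real.pi_pos])]
  convert smul_zero r
  rw [h5]
  congr 1
  ring

/-- Sub-mean value property of `|g|²` over a disc, with a weight that is at least `m` there. -/
lemma mul_sq_norm_le_integral_discMeasure {g : ℂ → ℂ} (hg : DifferentiableOn ℂ g (ball 0 1))
    {z : ℂ} {R m : ℝ} (hR : 0 < R) (hsub : closedBall z R ⊆ ball 0 1) (hm : 0 ≤ m) {h : ℂ → ℝ}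
    (h0 : ∀ w ∈ ball (0 : ℂ) 1, 0 ≤ h w) (hh : ∀ w ∈ ball z R, m ≤ h w)
    (hint : Integrable (fun w => ‖g w‖ ^ 2 * h w) discMeasure) :
    m * R ^ 2 * ‖g z‖ ^ 2 ≤ ∫ w, ‖g w‖ ^ 2 * h w ∂discMeasure := by
  have hsub' : ball z R ⊆ ball 0 1 := ball_subset_closedBall.trans hsub
  have hvol : volume.real (ball z R) = Real.pi * R ^ 2 := by
    simp [Measure.real, Complex.volume_ball, hR.le, mul_comm]
  have hcont : ContinuousOn g (closedBall z R) := hg.continuousOn.mono hsub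
  have hfin : volume (ball z R) ≠ ⊤ := measure_ball_lt_top.ne
  have hgi : IntegrableOn g (ball z R) :=
    (hcont.integrableOn_compact (isCompact_closedBall _ _)).mono_set ball_subset_closedBall
  have hgi2 : IntegrableOn (fun w => ‖g w‖ ^ 2) (ball z R) :=
    ((hcont.norm.pow 2).integrableOn_compact
      (isCompact_closedBall _ _)).mono_set ball_subset_closedBall
  have hci : IntegrableOn (fun _ => g z) (ball z R) := integrableOn_const hfin
  have hci2 : IntegrableOn (fun _ => ‖g z‖ ^ 2) (ball z R) := integrableOn_const hfin
  have hdi : IntegrableOn (fun w => g w - g z) (ball z R) := hgi.sub hci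
  have hzero : ∫ w in ball z R, (g w - g z) = 0 :=
    integral_ball_eq_zero ((hg.mono hsub').sub_const _) (sub_self _)
  have hcross : ∫ w in ball z R, 2 * ((starRingEnd ℂ) (g z) * (g w - g z)).re = 0 := by
    rw [integral_const_mul]
    have := integral_re (hdi.const_mul ((starRingEnd ℂ) (g z)))
    simp only [RCLike.re_to_complex] at this
    rw [this, integral_const_mul, hzero]
    simp
  have hcrossi : IntegrableOn (fun w => 2 * ((starRingEnd ℂ) (g z) * (g w - g z)).re)
      (ball z R) := (Integrable.re (hdi.const_mul ((starRingEnd ℂ) (g z)))).const_mul 2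
  -- `|g w|² ≥ |g z|² + 2 Re (conj (g z) (g w - g z))`, and the last term has mean zero
  have h1 : Real.pi * R ^ 2 * ‖g z‖ ^ 2 ≤ ∫ w in ball z R, ‖g w‖ ^ 2 := by
    have e : ∫ w in ball z R, (‖g z‖ ^ 2 + 2 * ((starRingEnd ℂ) (g z) * (g w - g z)).re) =
        Real.pi * R ^ 2 * ‖g z‖ ^ 2 := by
      rw [integral_add hci2 hcrossi, hcross, setIntegral_const, hvol,
        smul_eq_mul, add_zero]
    rw [← e]
    refine integral_mono (hci2.add hcrossi) hgi2 fun w => ?_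
    have : 0 ≤ Complex.normSq (g w - g z) := Complex.normSq_nonneg _
    simp only [← Complex.normSq_eq_norm_sq, Complex.normSq_apply, Complex.sub_re, Complex.sub_im,
      Complex.mul_re, Complex.conj_re, Complex.conj_im] at this ⊢
    linarith
  have hint' := integrable_discMeasure_iff.1 hint
  calc m * R ^ 2 * ‖g z‖ ^ 2 = Real.pi⁻¹ * (m * (Real.pi * R ^ 2 * ‖g z‖ ^ 2)) := by
        field_simp
    _ ≤ Real.pi⁻¹ * (m * ∫ w in ball z R, ‖g w‖ ^ 2) := by gcongr
    _ = Real.pi⁻¹ * ∫ w in ball z R, m * ‖g w‖ ^ 2 := by rw [integral_const_mul]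
    _ ≤ Real.pi⁻¹ * ∫ w in ball z R, ‖g w‖ ^ 2 * h w := by
        refine mul_le_mul_of_nonneg_left ?_ (by positivity)
        refine setIntegral_mono_on (hgi2.const_mul m) (hint'.mono_set hsub') measurableSet_ball ?_
        intro w hw
        rw [mul_comm]
        exact mul_le_mul_of_nonneg_left (hh w hw) (by positivity)
    _ ≤ Real.pi⁻¹ * ∫ w in ball (0 : ℂ) 1, ‖g w‖ ^ 2 * h w := by
        refine mul_le_mul_of_nonneg_left ?_ (by positivity)
        refine setIntegral_mono_set hint' ?_ hsub'.eventuallyLE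
        filter_upwards [ae_restrict_mem measurableSet_ball] with w hw
        exact mul_nonneg (by positivity) (h0 w hw)
    _ = _ := (integral_discMeasure _).symm

/-! ### Potentials -/

/-- The Szegő kernel `k_w(z) = 1 / (1 - conj w * z)` of the disc. -/
noncomputable def szegoKernel (w z : ℂ) : ℂ := (1 - (starRingEnd ℂ) w * z)⁻¹

lemma one_sub_norm_le_norm_one_sub {w z : ℂ} (hw : w ∈ ball (0 : ℂ) 1) :
    1 - ‖z‖ ≤ ‖1 - (starRingEnd ℂ) w * z‖ := by
  have h1 := norm_sub_norm_le (1 : ℂ) ((starRingEnd ℂ) w * z)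
  rw [norm_one, norm_mul, RCLike.norm_conj] at h1
  have : ‖w‖ * ‖z‖ ≤ ‖z‖ := mul_le_of_le_one_left (norm_nonneg _) (mem_ball_zero_iff.1 hw).le
  linarith

lemma one_sub_conj_mul_ne_zero {w z : ℂ} (hw : w ∈ ball (0 : ℂ) 1) (hz : z ∈ ball (0 : ℂ) 1) :
    1 - (starRingEnd ℂ) w * z ≠ 0 := by
  rw [← norm_pos_iff]
  exact lt_of_lt_of_le (by linarith [mem_ball_zero_iff.1 hz]) (one_sub_norm_le_norm_one_sub hw)

lemma norm_szegoKernel_le {w z : ℂ} {r : ℝ} (hr : r < 1) (hz : ‖z‖ ≤ r)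
    (hw : w ∈ ball (0 : ℂ) 1) : ‖szegoKernel w z‖ ≤ (1 - r)⁻¹ := by
  rw [szegoKernel, norm_inv]
  exact inv_anti₀ (by linarith) (by linarith [one_sub_norm_le_norm_one_sub (z := z) hw])

lemma hasDerivAt_szegoKernel {w z : ℂ} (hw : w ∈ ball (0 : ℂ) 1) (hz : z ∈ ball (0 : ℂ) 1) :
    HasDerivAt (szegoKernel w) ((starRingEnd ℂ) w * szegoKernel w z ^ 2) z := by
  have h1 : HasDerivAt (fun z => 1 - (starRingEnd ℂ) w * z) (-((starRingEnd ℂ) w * 1)) z :=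
    ((hasDerivAt_id z).const_mul _).const_sub 1
  refine (h1.inv (one_sub_conj_mul_ne_zero hw hz)).congr_deriv ?_
  simp [szegoKernel, div_eq_mul_inv]

lemma measurable_szegoKernel (z : ℂ) : Measurable (fun w => szegoKernel w z) := by
  unfold szegoKernel
  have : Measurable (starRingEnd ℂ) := Complex.continuous_conj.measurable
  fun_prop

lemma continuousAt_szegoKernel {w z : ℂ} (hw : w ∈ ball (0 : ℂ) 1) (hz : z ∈ ball (0 : ℂ) 1) :
    ContinuousAt (szegoKernel w) z := (hasDerivAt_szegoKernel hw hz).continuousAt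

/-- An integrable weight times a bounded measurable function is integrable. -/
lemma integrable_ofReal_mul_of_bounded {ω : ℂ → ℝ} (hω : Integrable ω discMeasure) {G : ℂ → ℂ}
    (hG : Measurable G) (hC : ∃ C, ∀ w ∈ ball (0 : ℂ) 1, ‖G w‖ ≤ C) :
    Integrable (fun w => (ω w : ℂ) * G w) discMeasure := by
  obtain ⟨C, hC⟩ := hC
  refine hω.ofReal.mul_bdd (c := C) hG.aestronglyMeasurable ?_
  filter_upwards [ae_discMeasure_mem_ball] with w hw using hC w hw

/-- The integral of `|k_w(z)|²` against a finite measure can be differentiated under the integral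
sign, since `|k_w(z)| ≤ 1 / (1 - |z|)` uniformly in `w`. -/
lemma hasDDbar_integral_szegoKernel {ω : ℂ → ℝ} (hω : Integrable ω discMeasure) :
    HasDDbar (fun z => ∫ w, ω w * ‖szegoKernel w z‖ ^ 2 ∂discMeasure)
      (fun z => ∫ w, (ω w : ℂ) * ((starRingEnd ℂ) w * szegoKernel w z ^ 2 *
        (starRingEnd ℂ) (szegoKernel w z)) ∂discMeasure)
      (fun z => ∫ w, ω w * ‖(starRingEnd ℂ) w * szegoKernel w z ^ 2‖ ^ 2 ∂discMeasure) := by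
  have mk := measurable_szegoKernel
  have mc : Measurable (starRingEnd ℂ) := Complex.continuous_conj.measurable
  have hint := fun G : ℂ → ℂ => integrable_ofReal_mul_of_bounded (G := G) hω
  -- the neighbourhood and the bound used for differentiation near a point
  have hnb : ∀ z ∈ ball (0 : ℂ) 1, ∃ r < 1, ball (0 : ℂ) r ∈ nhds z := fun z hz => by
    obtain ⟨r, h1, h2⟩ := exists_between (mem_ball_zero_iff.1 hz)
    exact ⟨r, h2, isOpen_ball.mem_nhds (mem_ball_zero_iff.2 h1)⟩
  have bound : ∀ r < 1, ∀ z ∈ ball (0 : ℂ) r, ∀ w ∈ ball (0 : ℂ) 1, ∀ n : ℕ,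
      ‖szegoKernel w z‖ ^ n ≤ (1 - r)⁻¹ ^ n := fun r hr z hz w hw n =>
    pow_le_pow_left₀ (norm_nonneg _)
      (norm_szegoKernel_le hr (mem_ball_zero_iff.1 hz).le hw) n
  set K := szegoKernel with hK
  set F : ℂ → ℂ → ℂ := fun z w => (ω w : ℂ) * (K w z * (starRingEnd ℂ) (K w z)) with hF
  set P : ℂ → ℂ → ℂ := fun z w => (ω w : ℂ) * ((starRingEnd ℂ) w * K w z ^ 2 *
    (starRingEnd ℂ) (K w z)) with hP
  set S : ℂ → ℂ → ℂ := fun z w => (ω w : ℂ) * (2 * (starRingEnd ℂ) w ^ 2 * K w z ^ 3 *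
    (starRingEnd ℂ) (K w z)) with hS
  set T : ℂ → ℂ → ℂ := fun z w => (ω w : ℂ) * ((starRingEnd ℂ) w * K w z ^ 2 *
    (starRingEnd ℂ) ((starRingEnd ℂ) w * K w z ^ 2)) with hT
  have nF : ∀ z w, ‖K w z * (starRingEnd ℂ) (K w z)‖ = ‖K w z‖ ^ 2 := fun z w => by
    simp; ring
  have nP : ∀ z, ∀ w ∈ ball (0 : ℂ) 1,
      ‖(starRingEnd ℂ) w * K w z ^ 2 * (starRingEnd ℂ) (K w z)‖ ≤ ‖K w z‖ ^ 3 := fun z w hw => by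
    have := (mem_ball_zero_iff.1 hw).le
    simp only [norm_mul, RCLike.norm_conj, norm_pow]
    nlinarith [pow_nonneg (norm_nonneg (K w z)) 3]
  have nS : ∀ z, ∀ w ∈ ball (0 : ℂ) 1,
      ‖2 * (starRingEnd ℂ) w ^ 2 * K w z ^ 3 * (starRingEnd ℂ) (K w z)‖ ≤ 2 * ‖K w z‖ ^ 4 :=
    fun z w hw => by
    have h2 : ‖w‖ ^ 2 ≤ 1 := pow_le_one₀ (norm_nonneg _) (mem_ball_zero_iff.1 hw).le
    simp only [norm_mul, RCLike.norm_conj, norm_pow, Complex.norm_ofNat]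
    nlinarith [pow_nonneg (norm_nonneg (K w z)) 4]
  have nT : ∀ z, ∀ w ∈ ball (0 : ℂ) 1,
      ‖(starRingEnd ℂ) w * K w z ^ 2 * (starRingEnd ℂ) ((starRingEnd ℂ) w * K w z ^ 2)‖ ≤
        ‖K w z‖ ^ 4 := fun z w hw => by
    have h2 : ‖w‖ ^ 2 ≤ 1 := pow_le_one₀ (norm_nonneg _) (mem_ball_zero_iff.1 hw).le
    simp only [norm_mul, RCLike.norm_conj, norm_pow]
    nlinarith [pow_nonneg (norm_nonneg (K w z)) 4]
  have mF : ∀ z, Measurable fun w => K w z * (starRingEnd ℂ) (K w z) := fun z => by fun_prop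
  have mP : ∀ z, Measurable fun w => (starRingEnd ℂ) w * K w z ^ 2 * (starRingEnd ℂ) (K w z) :=
    fun z => by fun_prop
  have mS : ∀ z, Measurable fun w => 2 * (starRingEnd ℂ) w ^ 2 * K w z ^ 3 *
    (starRingEnd ℂ) (K w z) := fun z => by fun_prop
  have mT : ∀ z, Measurable fun w => (starRingEnd ℂ) w * K w z ^ 2 *
    (starRingEnd ℂ) ((starRingEnd ℂ) w * K w z ^ 2) := fun z => by fun_prop
  have iF : ∀ r < 1, ∀ z ∈ ball (0 : ℂ) r, Integrable (F z) discMeasure := fun r hr z hz =>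
    hint _ (mF z) ⟨_, fun w hw => (nF z w).trans_le (bound r hr z hz w hw 2)⟩
  have iP : ∀ r < 1, ∀ z ∈ ball (0 : ℂ) r, Integrable (P z) discMeasure := fun r hr z hz =>
    hint _ (mP z) ⟨_, fun w hw => (nP z w hw).trans (bound r hr z hz w hw 3)⟩
  have iS : ∀ r < 1, ∀ z ∈ ball (0 : ℂ) r, Integrable (S z) discMeasure := fun r hr z hz =>
    hint _ (mS z) ⟨_, fun w hw => (nS z w hw).trans
      (mul_le_mul_of_nonneg_left (bound r hr z hz w hw 4) two_pos.le)⟩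
  have iT : ∀ r < 1, ∀ z ∈ ball (0 : ℂ) r, Integrable (T z) discMeasure := fun r hr z hz =>
    hint _ (mT z) ⟨_, fun w hw => (nT z w hw).trans (bound r hr z hz w hw 4)⟩
  have Tre : ∀ z, ∫ w, T z w ∂discMeasure =
      ((∫ w, ω w * ‖(starRingEnd ℂ) w * K w z ^ 2‖ ^ 2 ∂discMeasure : ℝ) : ℂ) := fun z => by
    rw [← integral_complex_ofReal]
    refine integral_congr_ae (.of_forall fun w => ?_)
    simp only [hT]
    rw [Complex.mul_conj']
    push_cast
    rfl
  have Fre : ∀ z, ∫ w, F z w ∂discMeasure =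
      ((∫ w, ω w * ‖K w z‖ ^ 2 ∂discMeasure : ℝ) : ℂ) := fun z => by
    rw [← integral_complex_ofReal]
    refine integral_congr_ae (.of_forall fun w => ?_)
    simp only [hF]
    rw [Complex.mul_conj']
    push_cast
    rfl
  have cK : ∀ z ∈ ball (0 : ℂ) 1, ∀ w ∈ ball (0 : ℂ) 1, ContinuousAt (K w) z :=
    fun z hz w hw => continuousAt_szegoKernel hw hz
  have contS : ContinuousOn (fun z => ∫ w, S z w ∂discMeasure) (ball 0 1) := by
    intro z hz
    obtain ⟨r, hr, hrz⟩ := hnb z hz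
    refine (continuousAt_of_dominated (bound := fun w => |ω w| * (2 * (1 - r)⁻¹ ^ 4))
      (Filter.mem_of_superset hrz fun y hy => (iS r hr y hy).aestronglyMeasurable) ?_
      (hω.abs.mul_const _) ?_).continuousWithinAt
    · refine Filter.mem_of_superset hrz fun y hy => ?_
      filter_upwards [ae_discMeasure_mem_ball] with w hw
      rw [hS, norm_mul, Complex.norm_real, Real.norm_eq_abs]
      refine mul_le_mul_of_nonneg_left ((nS y w hw).trans ?_) (abs_nonneg _)
      exact mul_le_mul_of_nonneg_left (bound r hr y hy w hw 4) two_pos.le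
    · filter_upwards [ae_discMeasure_mem_ball] with w hw
      have := cK z hz w hw
      have c2 : ContinuousAt (fun z => (starRingEnd ℂ) (K w z)) z :=
        Complex.continuous_conj.continuousAt.comp this
      exact continuousAt_const.mul ((continuousAt_const.mul (this.pow 3)).mul c2)
  have contT : ContinuousOn
      (fun z => ∫ w, ω w * ‖(starRingEnd ℂ) w * K w z ^ 2‖ ^ 2 ∂discMeasure) (ball 0 1) := by
    intro z hz
    obtain ⟨r, hr, hrz⟩ := hnb z hz
    refine (continuousAt_of_dominated (bound := fun w => |ω w| * (1 - r)⁻¹ ^ 4)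
      (Filter.Eventually.of_forall fun y => hω.aestronglyMeasurable.mul
        (Measurable.aestronglyMeasurable (by fun_prop))) ?_
      (hω.abs.mul_const _) ?_).continuousWithinAt
    · refine Filter.mem_of_superset hrz fun y hy => ?_
      filter_upwards [ae_discMeasure_mem_ball] with w hw
      rw [Pi.mul_apply, norm_mul, Real.norm_eq_abs, Real.norm_of_nonneg (by positivity)]
      refine mul_le_mul_of_nonneg_left (le_trans (le_of_eq ?_) ((nT y w hw).trans
        (bound r hr y hy w hw 4))) (abs_nonneg _)
      rw [norm_mul _ ((starRingEnd ℂ) _), RCLike.norm_conj, sq]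
    · filter_upwards [ae_discMeasure_mem_ball] with w hw
      have := cK z hz w hw
      exact continuousAt_const.mul ((continuousAt_const.mul (this.pow 2)).norm.pow 2)
  refine ⟨fun z => ∫ w, S z w ∂discMeasure, contS, contT, fun z hz => ?_⟩
  obtain ⟨r, hr, hrz⟩ := hnb z hz
  have hzr : z ∈ ball (0 : ℂ) r := mem_of_mem_nhds hrz
  have hr1 : 0 < 1 - r := by linarith
  have hsub : ball (0 : ℂ) r ⊆ ball 0 1 := ball_subset_ball hr.le
  constructor
  · have iQ : Integrable (fun w => (starRingEnd ℂ) (P z w)) discMeasure :=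
      (Complex.conjCLE : ℂ →L[ℝ] ℂ).integrable_comp (iP r hr z hzr)
    have key := HasWirtingerAt.integral (μ := discMeasure) (F := F) (P := P)
      (Q := fun z w => (starRingEnd ℂ) (P z w)) (bound := fun w => |ω w| * (2 * (1 - r)⁻¹ ^ 3))
      hrz (iF r hr) (iP r hr z hzr) iQ (hω.abs.mul_const _) ?_ ?_
    · simp only [Fre] at key
      exact key.congr_coeff rfl integral_conj
    · filter_upwards [ae_discMeasure_mem_ball] with w hw y hy
      rw [RCLike.norm_conj, ← two_mul, hP, norm_mul, Complex.norm_real, Real.norm_eq_abs]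
      have := mul_le_mul_of_nonneg_left ((nP y w hw).trans (bound r hr y hy w hw 3))
        (abs_nonneg (ω w))
      linarith
    · filter_upwards [ae_discMeasure_mem_ball] with w hw y hy
      have h1 := HasWirtingerAt.of_hasDerivAt (hasDerivAt_szegoKernel hw (hsub hy))
      have h2 := HasWirtingerAt.of_hasDerivAt (hasDerivAt_const y (ω w : ℂ))
      refine (h2.mul (h1.mul h1.conj)).congr_coeff ?_ ?_
      · simp only [hP, hK, map_zero]; ring
      · simp only [hP, hK, map_mul, map_pow, Complex.conj_conj, Complex.conj_ofReal]; ring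
  · have key := HasWirtingerAt.integral (μ := discMeasure) (F := P) (P := S)
      (Q := T) (bound := fun w => |ω w| * (3 * (1 - r)⁻¹ ^ 4))
      hrz (iP r hr) (iS r hr z hzr) (iT r hr z hzr) (hω.abs.mul_const _) ?_ ?_
    · exact key.congr_coeff rfl (Tre z)
    · filter_upwards [ae_discMeasure_mem_ball] with w hw y hy
      rw [hS, hT, norm_mul, norm_mul (ω w : ℂ), Complex.norm_real, Real.norm_eq_abs]
      have h4 := bound r hr y hy w hw 4
      have := mul_le_mul_of_nonneg_left ((nT y w hw).trans h4) (abs_nonneg (ω w))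
      have := mul_le_mul_of_nonneg_left ((nS y w hw).trans
        (mul_le_mul_of_nonneg_left h4 two_pos.le)) (abs_nonneg (ω w))
      linarith
    · filter_upwards [ae_discMeasure_mem_ball] with w hw y hy
      have h1 := HasWirtingerAt.of_hasDerivAt (hasDerivAt_szegoKernel hw (hsub hy))
      have h2 := HasWirtingerAt.of_hasDerivAt (hasDerivAt_const y (ω w : ℂ))
      have h3 := HasWirtingerAt.of_hasDerivAt (((hasDerivAt_szegoKernel hw (hsub hy)).pow 2
        ).const_mul ((starRingEnd ℂ) w))
      refine (h2.mul (h3.mul h1.conj)).congr_coeff ?_ ?_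
      · simp only [hS, hK, Pi.pow_apply, Nat.cast_ofNat, map_zero]; ring
      · simp only [hT, hK, Pi.pow_apply]; ring

lemma hasDDbar_one_sub_norm_sq :
    HasDDbar (fun z => 1 - ‖z‖ ^ 2) (fun z => -(starRingEnd ℂ) z) (fun _ => -1) := by
  have := (HasDDbar.const 1).add ((HasDDbar.normSq differentiableOn_id).const_mul (-1))
  simpa [sub_eq_add_neg] using! this

/-- The potential `V(z) = ∫ (1 - |z|²) |k_w(z)|² dμ(w)` of a finite measure `dμ = ω dm` satisfies
`-∂∂̄V(z) = ∫ (1 - |w|²) |k_w(z)|⁴ dμ(w)`. -/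
lemma exists_hasDDbar_potential {ω : ℂ → ℝ} (hω : Integrable ω discMeasure) :
    ∃ (p : ℂ → ℂ) (q : ℂ → ℝ),
      HasDDbar (fun z => (1 - ‖z‖ ^ 2) * ∫ w, ω w * ‖szegoKernel w z‖ ^ 2 ∂discMeasure) p q ∧
      ∀ z ∈ ball (0 : ℂ) 1,
        q z = -∫ w, ω w * ((1 - ‖w‖ ^ 2) * ‖szegoKernel w z‖ ^ 4) ∂discMeasure := by
  refine ⟨_, _, hasDDbar_one_sub_norm_sq.mul (hasDDbar_integral_szegoKernel hω), fun z hz => ?_⟩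
  have mk := measurable_szegoKernel z
  have mc : Measurable (starRingEnd ℂ) := Complex.continuous_conj.measurable
  have bk : ∀ w ∈ ball (0 : ℂ) 1, ‖szegoKernel w z‖ ≤ (1 - ‖z‖)⁻¹ := fun w hw =>
    norm_szegoKernel_le (mem_ball_zero_iff.1 hz) le_rfl hw
  have bw : ∀ w ∈ ball (0 : ℂ) 1, ‖w‖ ≤ 1 := fun w hw => (mem_ball_zero_iff.1 hw).le
  have hz0 : 0 ≤ (1 - ‖z‖)⁻¹ := inv_nonneg.2 (by linarith [mem_ball_zero_iff.1 hz])
  set C := (1 - ‖z‖)⁻¹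
  have i1 : Integrable (fun w => ω w * ‖(starRingEnd ℂ) w * szegoKernel w z ^ 2‖ ^ 2)
      discMeasure := by
    refine hω.mul_bdd (c := (1 * C ^ 2) ^ 2) (Measurable.aestronglyMeasurable (by fun_prop)) ?_
    filter_upwards [ae_discMeasure_mem_ball] with w hw
    rw [Real.norm_of_nonneg (by positivity), norm_mul, RCLike.norm_conj, norm_pow]
    have := bk w hw
    have := bw w hw
    gcongr
  have i2 : Integrable (fun w => ω w * ‖szegoKernel w z‖ ^ 2) discMeasure := by
    refine hω.mul_bdd (c := C ^ 2) (Measurable.aestronglyMeasurable (by fun_prop)) ?_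
    filter_upwards [ae_discMeasure_mem_ball] with w hw
    rw [Real.norm_of_nonneg (by positivity)]
    have := bk w hw
    gcongr
  have i3 : Integrable (fun w => (ω w : ℂ) * ((starRingEnd ℂ) w * szegoKernel w z ^ 2 *
      (starRingEnd ℂ) (szegoKernel w z))) discMeasure := by
    refine integrable_ofReal_mul_of_bounded hω (by fun_prop) ⟨1 * C ^ 2 * C, fun w hw => ?_⟩
    rw [norm_mul, norm_mul, RCLike.norm_conj, RCLike.norm_conj, norm_pow]
    have := bk w hw
    have := bw w hw
    gcongr
  have i3' := i3.const_mul (-z)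
  have e3 : (-(starRingEnd ℂ) z * (starRingEnd ℂ) (∫ w, (ω w : ℂ) * ((starRingEnd ℂ) w *
      szegoKernel w z ^ 2 * (starRingEnd ℂ) (szegoKernel w z)) ∂discMeasure)).re =
      ∫ w, (-z * ((ω w : ℂ) * ((starRingEnd ℂ) w *
      szegoKernel w z ^ 2 * (starRingEnd ℂ) (szegoKernel w z)))).re ∂discMeasure := by
    have := integral_re i3'
    simp only [RCLike.re_to_complex] at this
    rw [this, integral_const_mul, ← map_neg, ← map_mul, Complex.conj_re]
  have i3re : Integrable (fun w => (-z * ((ω w : ℂ) * ((starRingEnd ℂ) w *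
      szegoKernel w z ^ 2 * (starRingEnd ℂ) (szegoKernel w z)))).re) discMeasure := i3'.re
  have i12 : Integrable (fun w => (1 - ‖z‖ ^ 2) * (ω w * ‖(starRingEnd ℂ) w *
      szegoKernel w z ^ 2‖ ^ 2) + ω w * ‖szegoKernel w z‖ ^ 2 * -1) discMeasure :=
    (i1.const_mul _).add (i2.mul_const _)
  simp only [e3]
  rw [← integral_const_mul, ← integral_mul_const, ← integral_const_mul,
    ← integral_add (i1.const_mul _) (i2.mul_const _),
    ← integral_add i12 (i3re.const_mul 2), ← integral_neg]
  refine integral_congr_ae ?_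
  filter_upwards [ae_discMeasure_mem_ball] with w hw
  -- `k² k̄ = |k|⁴ (1 - w z̄)` and `|k|² = |k|⁴ |1 - w̄ z|²`
  set k := szegoKernel w z with hk
  set d := 1 - (starRingEnd ℂ) w * z with hd
  have hkd : k * d = 1 := inv_mul_cancel₀ (one_sub_conj_mul_ne_zero hw hz)
  have hn : ‖k‖ ^ 2 * ‖d‖ ^ 2 = 1 := by rw [← mul_pow, ← norm_mul, hkd]; simp
  have h1 : k ^ 2 * (starRingEnd ℂ) k = ((‖k‖ ^ 4 : ℝ) : ℂ) * (starRingEnd ℂ) d := by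
    have hkd' : (starRingEnd ℂ) k * (starRingEnd ℂ) d = 1 := by rw [← map_mul, hkd, map_one]
    have : ((‖k‖ ^ 4 : ℝ) : ℂ) = (k * (starRingEnd ℂ) k) ^ 2 := by
      rw [Complex.mul_conj']; push_cast; ring
    rw [this]
    linear_combination (-k ^ 2 * (starRingEnd ℂ) k) * hkd'
  have h2 : ‖k‖ ^ 2 = ‖k‖ ^ 4 * ‖d‖ ^ 2 := by linear_combination (-‖k‖ ^ 2) * hn
  have h3 : (-z * ((ω w : ℂ) * ((starRingEnd ℂ) w * k ^ 2 * (starRingEnd ℂ) k))).re =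
      -(ω w * ‖k‖ ^ 4 * (z * (starRingEnd ℂ) w * (starRingEnd ℂ) d).re) := by
    rw [mul_assoc _ (k ^ 2), h1, ← Complex.re_ofReal_mul, ← Complex.neg_re]
    congr 1
    push_cast
    ring
  have h4 : (1 - ‖z‖ ^ 2) * ‖w‖ ^ 2 - ‖d‖ ^ 2 - 2 * (z * (starRingEnd ℂ) w * (starRingEnd ℂ) d).re
      = -(1 - ‖w‖ ^ 2) := by
    simp only [← Complex.normSq_eq_norm_sq, Complex.normSq_apply, hd, Complex.sub_re,
      Complex.sub_im, Complex.mul_re, Complex.mul_im, Complex.conj_re, Complex.conj_im,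
      Complex.one_re, Complex.one_im]
    ring
  rw [h3, norm_mul, RCLike.norm_conj, norm_pow]
  linear_combination (ω w * ‖k‖ ^ 4) * h4 - ω w * h2

/-! ### Disc automorphisms -/

lemma one_sub_norm_discAut_sq {a w : ℂ} (ha : a ∈ ball (0 : ℂ) 1) (hw : w ∈ ball (0 : ℂ) 1) :
    1 - ‖discAut a w‖ ^ 2 = (1 - ‖a‖ ^ 2) * (1 - ‖w‖ ^ 2) * ‖szegoKernel w a‖ ^ 2 := by
  have h0 := one_sub_conj_mul_ne_zero hw ha
  have h1 : ‖1 - (starRingEnd ℂ) a * w‖ = ‖1 - (starRingEnd ℂ) w * a‖ := by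
    rw [← RCLike.norm_conj]
    simp [mul_comm]
  have h2 : ‖1 - (starRingEnd ℂ) w * a‖ ≠ 0 := norm_ne_zero_iff.2 h0
  have h3 : ‖1 - (starRingEnd ℂ) w * a‖ ^ 2 - ‖a - w‖ ^ 2 = (1 - ‖a‖ ^ 2) * (1 - ‖w‖ ^ 2) := by
    simp only [← Complex.normSq_eq_norm_sq, Complex.normSq_apply, Complex.sub_re,
      Complex.sub_im, Complex.mul_re, Complex.mul_im, Complex.conj_re, Complex.conj_im,
      Complex.one_re, Complex.one_im]
    ring
  rw [discAut, szegoKernel, norm_div, norm_inv, h1, ← h3, div_pow, inv_pow, sub_mul,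
    mul_inv_cancel₀ (pow_ne_zero 2 h2), div_eq_mul_inv]

lemma one_sub_norm_sq_pos {z : ℂ} (hz : z ∈ ball (0 : ℂ) 1) : 0 < 1 - ‖z‖ ^ 2 := by
  have := mem_ball_zero_iff.1 hz
  nlinarith [norm_nonneg z]

lemma mapsTo_discAut {a : ℂ} (ha : a ∈ ball (0 : ℂ) 1) :
    Set.MapsTo (discAut a) (ball 0 1) (ball 0 1) := by
  intro w hw
  have h1 := one_sub_norm_discAut_sq ha hw
  have h2 : 0 < ‖szegoKernel w a‖ :=
    norm_pos_iff.2 (inv_ne_zero (one_sub_conj_mul_ne_zero hw ha))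
  have h3 := one_sub_norm_sq_pos ha
  have h4 := one_sub_norm_sq_pos hw
  have h5 : 0 < 1 - ‖discAut a w‖ ^ 2 := by rw [h1]; positivity
  rw [mem_ball_zero_iff]
  exact lt_of_pow_lt_pow_left₀ 2 zero_le_one (by linarith)

lemma differentiableOn_discAut {a : ℂ} (ha : a ∈ ball (0 : ℂ) 1) :
    DifferentiableOn ℂ (discAut a) (ball 0 1) := by
  intro w hw
  have := one_sub_conj_mul_ne_zero ha hw
  unfold discAut
  have h1 : DifferentiableAt ℂ (fun z => a - z) w := by fun_prop
  have h2 : DifferentiableAt ℂ (fun z => 1 - (starRingEnd ℂ) a * z) w := by fun_prop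
  exact (h1.div h2 this).differentiableWithinAt

/-! ### The potential of the coefficient -/

/-- The density of the measure `|A(w)|² (1 - |w|²)³ dm(w)`, with respect to `dm`. -/
noncomputable def coeffWeight (A : ℂ → ℂ) (w : ℂ) : ℝ := ‖A w‖ ^ 2 * (1 - ‖w‖ ^ 2) ^ 3

/-- The potential `V(z) = ∫ |A(w)|² (1 - |w|²)² (1 - |φ_z(w)|²) dm(w)`, written with the
identity `1 - |φ_z(w)|² = (1 - |z|²) (1 - |w|²) |k_w(z)|²`. -/
noncomputable def coeffPotential (A : ℂ → ℂ) (z : ℂ) : ℝ :=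
  (1 - ‖z‖ ^ 2) * ∫ w, coeffWeight A w * ‖szegoKernel w z‖ ^ 2 ∂discMeasure

section Coefficient

variable {A : ℂ → ℂ} {ε : ℝ}

lemma coeffWeight_nonneg {w : ℂ} (hw : w ∈ ball (0 : ℂ) 1) : 0 ≤ coeffWeight A w :=
  mul_nonneg (by positivity) (pow_nonneg (one_sub_norm_sq_pos hw).le 3)

lemma log_exp_one_div {z : ℂ} (hz : z ∈ ball (0 : ℂ) 1) :
    Real.log (Real.exp 1 / (1 - ‖z‖)) = 1 - Real.log (1 - ‖z‖) := by
  have := mem_ball_zero_iff.1 hz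
  rw [Real.log_div (Real.exp_ne_zero 1) (by linarith), Real.log_exp]

lemma one_le_one_sub_log {z : ℂ} (hz : z ∈ ball (0 : ℂ) 1) : 1 ≤ 1 - Real.log (1 - ‖z‖) := by
  have := mem_ball_zero_iff.1 hz
  have := Real.log_nonpos (x := 1 - ‖z‖) (by linarith) (by linarith [norm_nonneg z])
  linarith

lemma coeffPotential_eq_integrand {z w : ℂ} (hz : z ∈ ball (0 : ℂ) 1) (hw : w ∈ ball (0 : ℂ) 1) :
    ‖A w‖ ^ 2 * (1 - ‖w‖ ^ 2) ^ 2 * (1 - ‖discAut z w‖ ^ 2) =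
      (1 - ‖z‖ ^ 2) * (coeffWeight A w * ‖szegoKernel w z‖ ^ 2) := by
  rw [one_sub_norm_discAut_sq hz hw, coeffWeight]
  ring

lemma lintegral_le_of_lmoaSecondNormSq_le (hA : lmoaSecondNormSq A ≤ ENNReal.ofReal ε)
    {z : ℂ} (hz : z ∈ ball (0 : ℂ) 1) :
    ENNReal.ofReal ((1 - Real.log (1 - ‖z‖)) ^ 2) *
      ∫⁻ w, ENNReal.ofReal ((1 - ‖z‖ ^ 2) * (coeffWeight A w * ‖szegoKernel w z‖ ^ 2))
        ∂discMeasure ≤ ENNReal.ofReal ε := by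
  refine le_trans (le_trans (le_of_eq ?_) (le_iSup₂ (f := fun a (_ : a ∈ ball (0 : ℂ) 1) =>
    ENNReal.ofReal (Real.log (Real.exp 1 / (1 - ‖a‖)) ^ 2) *
      ∫⁻ z, ENNReal.ofReal
        (‖A z‖ ^ 2 * (1 - ‖z‖ ^ 2) ^ 2 * (1 - ‖discAut a z‖ ^ 2)) ∂discMeasure) z hz)) hA
  simp only [log_exp_one_div hz]
  congr 1
  refine lintegral_congr_ae ?_
  filter_upwards [ae_discMeasure_mem_ball] with w hw
  rw [coeffPotential_eq_integrand hz hw]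

lemma integrable_coeffWeight (hd : DifferentiableOn ℂ A (ball 0 1))
    (hA : lmoaSecondNormSq A ≤ ENNReal.ofReal ε) : Integrable (coeffWeight A) discMeasure := by
  have hm : AEStronglyMeasurable (coeffWeight A) discMeasure := by
    refine ContinuousOn.aestronglyMeasurable_discMeasure ?_
    exact (hd.continuousOn.norm.pow 2).mul (by fun_prop)
  refine ⟨hm, ?_⟩
  rw [hasFiniteIntegral_iff_ofReal (by
    filter_upwards [ae_discMeasure_mem_ball] with w hw using coeffWeight_nonneg hw)]
  have := lintegral_le_of_lmoaSecondNormSq_le hA (mem_ball_self one_pos)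
  simp [szegoKernel] at this
  exact this.trans_lt ENNReal.ofReal_lt_top

lemma integrable_coeffWeight_mul (hw : Integrable (coeffWeight A) discMeasure) {z : ℂ}
    (hz : z ∈ ball (0 : ℂ) 1) (n : ℕ) :
    Integrable (fun w => coeffWeight A w * ‖szegoKernel w z‖ ^ n) discMeasure := by
  refine hw.mul_bdd (c := (1 - ‖z‖)⁻¹ ^ n)
    ((measurable_szegoKernel z).norm.pow_const n).aestronglyMeasurable ?_
  filter_upwards [ae_discMeasure_mem_ball] with w hw
  rw [Real.norm_of_nonneg (by positivity)]
  have := norm_szegoKernel_le (mem_ball_zero_iff.1 hz) le_rfl hw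
  gcongr

lemma coeffPotential_nonneg {z : ℂ} (hz : z ∈ ball (0 : ℂ) 1) : 0 ≤ coeffPotential A z := by
  refine mul_nonneg (one_sub_norm_sq_pos hz).le (integral_nonneg_of_ae ?_)
  filter_upwards [ae_discMeasure_mem_ball] with w hw
  exact mul_nonneg (coeffWeight_nonneg hw) (by positivity)

lemma log_sq_mul_coeffPotential_le (hε : 0 ≤ ε) (hd : DifferentiableOn ℂ A (ball 0 1))
    (hA : lmoaSecondNormSq A ≤ ENNReal.ofReal ε) {z : ℂ} (hz : z ∈ ball (0 : ℂ) 1) :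
    (1 - Real.log (1 - ‖z‖)) ^ 2 * coeffPotential A z ≤ ε := by
  have h := lintegral_le_of_lmoaSecondNormSq_le hA hz
  have hi := (integrable_coeffWeight_mul (integrable_coeffWeight hd hA) hz 2).const_mul
    (1 - ‖z‖ ^ 2)
  rw [← ofReal_integral_eq_lintegral_ofReal hi, ← ENNReal.ofReal_mul (by positivity),
    ENNReal.ofReal_le_ofReal_iff hε, integral_const_mul] at h
  · exact h
  · filter_upwards [ae_discMeasure_mem_ball] with w hw
    exact mul_nonneg (one_sub_norm_sq_pos hz).le
      (mul_nonneg (coeffWeight_nonneg hw) (by positivity))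

lemma coeffPotential_le (hε : 0 ≤ ε) (hd : DifferentiableOn ℂ A (ball 0 1))
    (hA : lmoaSecondNormSq A ≤ ENNReal.ofReal ε) {z : ℂ} (hz : z ∈ ball (0 : ℂ) 1) :
    coeffPotential A z ≤ ε := by
  have h1 := log_sq_mul_coeffPotential_le hε hd hA hz
  have h2 := one_le_one_sub_log hz
  have h3 := coeffPotential_nonneg (A := A) hz
  nlinarith [mul_nonneg h3 (by nlinarith : 0 ≤ (1 - Real.log (1 - ‖z‖)) ^ 2 - 1)]

/-- The disc `D(z, (1 - |z|) / 2)`, on which `1 - |w|²` and `1 / |k_w(z)|` are comparable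
to `1 - |z|`. -/
lemma half_ball_estimates {z w : ℂ} (hz : z ∈ ball (0 : ℂ) 1)
    (hw : w ∈ ball z ((1 - ‖z‖) / 2)) :
    (1 - ‖z‖) / 2 ≤ 1 - ‖w‖ ^ 2 ∧ 2 / (5 * (1 - ‖z‖)) ≤ ‖szegoKernel w z‖ := by
  have hz1 := mem_ball_zero_iff.1 hz
  have hz0 := norm_nonneg z
  have hwz : ‖w - z‖ < (1 - ‖z‖) / 2 := by rwa [mem_ball, dist_eq_norm] at hw
  have hw1 : ‖w‖ ≤ ‖w - z‖ + ‖z‖ := by simpa using norm_add_le (w - z) z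
  have hw2 : ‖w‖ < 1 := by linarith
  constructor
  · nlinarith [norm_nonneg w]
  · have hne := one_sub_conj_mul_ne_zero (mem_ball_zero_iff.2 hw2) hz
    have h1 : 1 - (starRingEnd ℂ) w * z =
        ((1 - ‖z‖ ^ 2 : ℝ) : ℂ) - (starRingEnd ℂ) (w - z) * z := by
      have : ((‖z‖ ^ 2 : ℝ) : ℂ) = (starRingEnd ℂ) z * z := by
        rw [Complex.conj_mul']; push_cast; rfl
      rw [Complex.ofReal_sub, this, map_sub]
      push_cast
      ring
    have h2 : ‖1 - (starRingEnd ℂ) w * z‖ ≤ (1 - ‖z‖ ^ 2) + ‖w - z‖ * ‖z‖ := by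
      rw [h1]
      refine (norm_sub_le _ _).trans (le_of_eq ?_)
      rw [Complex.norm_real, Real.norm_of_nonneg (one_sub_norm_sq_pos hz).le, norm_mul,
        RCLike.norm_conj]
    have h3 : ‖1 - (starRingEnd ℂ) w * z‖ ≤ 5 * (1 - ‖z‖) / 2 := by
      nlinarith [norm_nonneg (w - z)]
    rw [szegoKernel, norm_inv, ← inv_div]
    exact inv_anti₀ (norm_pos_iff.2 hne) h3

lemma closedBall_half_subset {z : ℂ} (hz : z ∈ ball (0 : ℂ) 1) :
    closedBall z ((1 - ‖z‖) / 2) ⊆ ball 0 1 := by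
  intro w hw
  have hz1 := mem_ball_zero_iff.1 hz
  rw [mem_closedBall, dist_eq_norm] at hw
  have : ‖w‖ ≤ ‖w - z‖ + ‖z‖ := by simpa using norm_add_le (w - z) z
  rw [mem_ball_zero_iff]
  linarith

/-- Pointwise bound for the coefficient by its potential, from the sub-mean value property of `|A|²`
on the disc `D(z, (1 - |z|) / 2)`. -/
lemma sq_norm_mul_le_coeffPotential (hd : DifferentiableOn ℂ A (ball 0 1))
    (hw : Integrable (coeffWeight A) discMeasure) {z : ℂ} (hz : z ∈ ball (0 : ℂ) 1) :
    ‖A z‖ ^ 2 * (1 - ‖z‖) ^ 4 ≤ 200 * coeffPotential A z := by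
  have hz1 := mem_ball_zero_iff.1 hz
  have hz0 := norm_nonneg z
  have ht : 0 < 1 - ‖z‖ := by linarith
  have key := mul_sq_norm_le_integral_discMeasure hd (half_pos ht) (closedBall_half_subset hz)
    (m := ((1 - ‖z‖) / 2) ^ 3 * (2 / (5 * (1 - ‖z‖))) ^ 2) (by positivity)
    (h := fun w => (1 - ‖w‖ ^ 2) ^ 3 * ‖szegoKernel w z‖ ^ 2)
    (fun w hw => mul_nonneg (pow_nonneg (one_sub_norm_sq_pos hw).le 3) (by positivity))
    (fun w hw => by
      obtain ⟨h1, h2⟩ := half_ball_estimates hz hw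
      have : (0 : ℝ) ≤ 1 - ‖w‖ ^ 2 := by linarith
      gcongr)
    (by simpa only [coeffWeight, mul_assoc] using integrable_coeffWeight_mul hw hz 2)
  have e : ∫ w, ‖A w‖ ^ 2 * ((1 - ‖w‖ ^ 2) ^ 3 * ‖szegoKernel w z‖ ^ 2) ∂discMeasure =
      ∫ w, coeffWeight A w * ‖szegoKernel w z‖ ^ 2 ∂discMeasure := by
    simp only [coeffWeight, mul_assoc]
  rw [e] at key
  have e2 : ((1 - ‖z‖) / 2) ^ 3 * (2 / (5 * (1 - ‖z‖))) ^ 2 * ((1 - ‖z‖) / 2) ^ 2 * ‖A z‖ ^ 2 =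
      ‖A z‖ ^ 2 * (1 - ‖z‖) ^ 3 / 200 := by
    field_simp
    ring
  rw [e2] at key
  have hI : 0 ≤ ∫ w, coeffWeight A w * ‖szegoKernel w z‖ ^ 2 ∂discMeasure :=
    le_trans (by positivity) key
  have h5 : (1 - ‖z‖) * ∫ w, coeffWeight A w * ‖szegoKernel w z‖ ^ 2 ∂discMeasure ≤
      coeffPotential A z := by
    refine mul_le_mul_of_nonneg_right ?_ hI
    nlinarith
  have h6 := mul_le_mul_of_nonneg_left key ht.le
  have h7 : ‖A z‖ ^ 2 * (1 - ‖z‖) ^ 4 =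
    200 * ((1 - ‖z‖) * (‖A z‖ ^ 2 * (1 - ‖z‖) ^ 3 / 200)) := by ring
  rw [h7]
  linarith

/-- The coefficient is controlled by the Laplacian of its potential: the integral is
`-∂∂̄V(z)`. -/
lemma sq_norm_mul_le_integral (hd : DifferentiableOn ℂ A (ball 0 1))
    (hw : Integrable (coeffWeight A) discMeasure) {z : ℂ} (hz : z ∈ ball (0 : ℂ) 1) :
    (1 - ‖z‖ ^ 2) ^ 2 * ‖A z‖ ^ 2 ≤
      10000 * ∫ w, coeffWeight A w * ((1 - ‖w‖ ^ 2) * ‖szegoKernel w z‖ ^ 4) ∂discMeasure := by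
  have hz1 := mem_ball_zero_iff.1 hz
  have hz0 := norm_nonneg z
  have ht : 0 < 1 - ‖z‖ := by linarith
  have hi : Integrable (fun w => coeffWeight A w * ((1 - ‖w‖ ^ 2) * ‖szegoKernel w z‖ ^ 4))
      discMeasure := by
    have := (integrable_coeffWeight_mul hw hz 4).mul_bdd (c := 1)
      (g := fun w => 1 - ‖w‖ ^ 2) (Measurable.aestronglyMeasurable (by fun_prop)) (by
        filter_upwards [ae_discMeasure_mem_ball] with w hw
        rw [Real.norm_of_nonneg (one_sub_norm_sq_pos hw).le]
        nlinarith [norm_nonneg w])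
    refine this.congr (.of_forall fun w => ?_)
    ring
  have key := mul_sq_norm_le_integral_discMeasure hd (half_pos ht) (closedBall_half_subset hz)
    (m := ((1 - ‖z‖) / 2) ^ 3 * ((1 - ‖z‖) / 2 * (2 / (5 * (1 - ‖z‖))) ^ 4)) (by positivity)
    (h := fun w => (1 - ‖w‖ ^ 2) ^ 3 * ((1 - ‖w‖ ^ 2) * ‖szegoKernel w z‖ ^ 4))
    (fun w hw => mul_nonneg (pow_nonneg (one_sub_norm_sq_pos hw).le 3)
      (mul_nonneg (one_sub_norm_sq_pos hw).le (by positivity)))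
    (fun w hw => by
      obtain ⟨h1, h2⟩ := half_ball_estimates hz hw
      have : (0 : ℝ) ≤ 1 - ‖w‖ ^ 2 := by linarith
      gcongr)
    (by simpa only [coeffWeight, mul_assoc] using hi)
  have e : ∫ w, ‖A w‖ ^ 2 * ((1 - ‖w‖ ^ 2) ^ 3 * ((1 - ‖w‖ ^ 2) * ‖szegoKernel w z‖ ^ 4))
      ∂discMeasure =
      ∫ w, coeffWeight A w * ((1 - ‖w‖ ^ 2) * ‖szegoKernel w z‖ ^ 4) ∂discMeasure := by
    simp only [coeffWeight, mul_assoc]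
  rw [e] at key
  have e2 : ((1 - ‖z‖) / 2) ^ 3 * ((1 - ‖z‖) / 2 * (2 / (5 * (1 - ‖z‖))) ^ 4) *
      ((1 - ‖z‖) / 2) ^ 2 * ‖A z‖ ^ 2 = (1 - ‖z‖) ^ 2 * ‖A z‖ ^ 2 / 2500 := by
    field_simp
    ring
  rw [e2] at key
  have h5 : (1 - ‖z‖ ^ 2) ^ 2 ≤ 4 * (1 - ‖z‖) ^ 2 := by
    have : 1 - ‖z‖ ^ 2 = (1 - ‖z‖) * (1 + ‖z‖) := by ring
    rw [this, mul_pow, mul_comm]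
    gcongr
    nlinarith
  have h6 := mul_le_mul_of_nonneg_right h5 (sq_nonneg ‖A z‖)
  linarith

end Coefficient

/-! ### Solutions are Bloch functions -/

/-- Growth of a holomorphic function along a radius, from a radial majorant of its derivative. -/
lemma norm_le_of_norm_deriv_le {g : ℂ → ℂ} (hg : DifferentiableOn ℂ g (ball 0 1)) {B B' : ℝ → ℝ}
    (hB : ∀ s ∈ Set.Ico (0 : ℝ) 1, HasDerivAt B (B' s) s) {z : ℂ} (hz : z ∈ ball (0 : ℂ) 1)
    (h : ∀ ζ : ℂ, ‖ζ‖ ≤ ‖z‖ → ‖deriv g ζ‖ ≤ B' ‖ζ‖) : ‖g z‖ ≤ ‖g 0‖ + (B ‖z‖ - B 0) := by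
  rcases eq_or_ne z 0 with rfl | hz0
  · simp
  have hz1 := mem_ball_zero_iff.1 hz
  have hzn : 0 < ‖z‖ := norm_pos_iff.2 hz0
  set u : ℂ := z / ‖z‖ with hu
  have hun : ‖u‖ = 1 := by
    rw [hu, norm_div, Complex.norm_real, norm_norm, div_self hzn.ne']
  have hns : ∀ s : ℝ, 0 ≤ s → ‖(s : ℂ) * u‖ = s := fun s hs => by
    rw [norm_mul, hun, mul_one, Complex.norm_real, Real.norm_of_nonneg hs]
  have hder : ∀ s ∈ Set.Icc 0 ‖z‖,
      HasDerivAt (fun s : ℝ => g (s * u)) (deriv g (s * u) * u) s := by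
    intro s hs
    have h1 : HasDerivAt (fun s : ℝ => (s : ℂ) * u) u s := by
      simpa using (Complex.ofRealCLM.hasDerivAt (x := s)).mul_const u
    have hmem : (s : ℂ) * u ∈ ball (0 : ℂ) 1 := by
      rw [mem_ball_zero_iff, hns s hs.1]; linarith [hs.2]
    have h2 := (hg.differentiableAt (isOpen_ball.mem_nhds hmem)).hasDerivAt
    exact HasDerivAt.comp s h2 h1
  have hB1 : ∀ s ∈ Set.Icc 0 ‖z‖, HasDerivAt (fun s => ‖g 0‖ + (B s - B 0)) (B' s) s :=
    fun s hs => ((hB s ⟨hs.1, by linarith [hs.2]⟩).sub_const _).const_add _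
  have key := image_norm_le_of_norm_deriv_right_le_deriv_boundary'
    (f := fun s : ℝ => g (s * u)) (f' := fun s => deriv g (s * u) * u) (a := 0) (b := ‖z‖)
    (fun s hs => (hder s hs).continuousAt.continuousWithinAt)
    (fun s hs => (hder s ⟨hs.1, hs.2.le⟩).hasDerivWithinAt)
    (B := fun s => ‖g 0‖ + (B s - B 0)) (B' := B') (by simp)
    (fun s hs => (hB1 s hs).continuousAt.continuousWithinAt)
    (fun s hs => (hB1 s ⟨hs.1, hs.2.le⟩).hasDerivWithinAt)
    (fun s hs => by
      have := h (s * u) (by rw [hns s hs.1]; exact hs.2.le)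
      rwa [hns s hs.1, ← mul_one ‖deriv g _‖, ← hun, ← norm_mul] at this)
    (Set.right_mem_Icc.2 hzn.le)
  have hzu : ((‖z‖ : ℝ) : ℂ) * u = z := by
    rw [hu, mul_div_cancel₀ _ (Complex.ofReal_ne_zero.2 hzn.ne')]
  simpa only [hzu] using key

/-- If `f'' + A f = 0` with `|A(z)| (1 - |z|)² log (e / (1 - |z|)) ≤ 1 / 2`, then `f` is a Bloch
function, and hence of logarithmic growth. -/
lemma exists_bloch_bound {A f : ℂ → ℂ} (hf : DifferentiableOn ℂ f (ball 0 1))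
    (hode : ∀ z ∈ ball (0 : ℂ) 1, deriv (deriv f) z + A z * f z = 0)
    (hA : ∀ z ∈ ball (0 : ℂ) 1, ‖A z‖ * (1 - ‖z‖) ^ 2 * (1 - Real.log (1 - ‖z‖)) ≤ 1 / 2) :
    ∃ β K : ℝ, 0 ≤ β ∧ 0 ≤ K ∧ ∀ z ∈ ball (0 : ℂ) 1,
      (1 - ‖z‖) * ‖deriv f z‖ ≤ β ∧ ‖f z‖ ≤ K * (1 - Real.log (1 - ‖z‖)) := by
  have hf' : DifferentiableOn ℂ (deriv f) (ball 0 1) := hf.deriv isOpen_ball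
  -- the growth bound on a smaller disc, given the Bloch bound there
  have growth : ∀ b, 0 ≤ b → ∀ z ∈ ball (0 : ℂ) 1,
      (∀ ζ : ℂ, ‖ζ‖ ≤ ‖z‖ → (1 - ‖ζ‖) * ‖deriv f ζ‖ ≤ b) →
      ‖f z‖ ≤ (‖f 0‖ + b) * (1 - Real.log (1 - ‖z‖)) := by
    intro b hb z hz h
    have hz1 := mem_ball_zero_iff.1 hz
    have key := norm_le_of_norm_deriv_le hf (B := fun s => -(b * Real.log (1 - s)))
      (B' := fun s => b / (1 - s)) (fun s hs => by
        have h1 : HasDerivAt (fun s : ℝ => 1 - s) (-1) s := (hasDerivAt_id s).const_sub 1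
        have h2 := ((h1.log (by linarith [hs.2])).const_mul b).neg
        refine h2.congr_deriv ?_
        ring) hz (fun ζ hζ => by
        rw [le_div_iff₀ (by linarith), mul_comm]
        exact h ζ hζ)
    have := one_le_one_sub_log hz
    simp only [sub_zero, Real.log_one, mul_zero, neg_zero] at key
    nlinarith [mul_nonneg (norm_nonneg (f 0)) (sub_nonneg.2 this)]
  have bloch : ∀ z ∈ ball (0 : ℂ) 1,
      (1 - ‖z‖) * ‖deriv f z‖ ≤ 2 * ‖deriv f 0‖ + ‖f 0‖ := by
    intro z hz
    have hz1 := mem_ball_zero_iff.1 hz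
    have hsub : closedBall (0 : ℂ) ‖z‖ ⊆ ball 0 1 := closedBall_subset_ball hz1
    obtain ⟨z₀, hz₀, hmax⟩ := (isCompact_closedBall (0 : ℂ) ‖z‖).exists_isMaxOn
      ⟨0, by simp⟩ (f := fun ζ => (1 - ‖ζ‖) * ‖deriv f ζ‖)
      ((continuousOn_const.sub continuousOn_id.norm).mul (hf'.continuousOn.mono hsub).norm)
    have hz₀n : ‖z₀‖ ≤ ‖z‖ := by simpa using hz₀
    have hz₀1 : ‖z₀‖ < 1 := by linarith
    set b := (1 - ‖z₀‖) * ‖deriv f z₀‖ with hb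
    have hb0 : 0 ≤ b := mul_nonneg (by linarith) (norm_nonneg _)
    have hle : ∀ ζ : ℂ, ‖ζ‖ ≤ ‖z‖ → (1 - ‖ζ‖) * ‖deriv f ζ‖ ≤ b := fun ζ hζ =>
      hmax (by simpa using hζ)
    set c := (‖f 0‖ + b) / 2 with hc
    have hc0 : 0 ≤ c := by positivity
    have key := norm_le_of_norm_deriv_le hf' (B := fun s => c / (1 - s))
      (B' := fun s => c / (1 - s) ^ 2) (fun s hs => by
        have h1 : HasDerivAt (fun s : ℝ => 1 - s) (-1) s := (hasDerivAt_id s).const_sub 1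
        have h2 := (h1.inv (by linarith [hs.2])).const_mul c
        refine h2.congr_deriv ?_
        ring) (z := z₀) (mem_ball_zero_iff.2 hz₀1) (fun ζ hζ => by
        have hζ1 : ζ ∈ ball (0 : ℂ) 1 := mem_ball_zero_iff.2 (by linarith)
        have h1 := growth b hb0 ζ hζ1 fun ξ hξ => hle ξ (by linarith)
        have h2 := hA ζ hζ1
        have h3 : deriv (deriv f) ζ = -(A ζ * f ζ) := eq_neg_of_add_eq_zero_left (hode ζ hζ1)
        rw [h3, norm_neg, norm_mul, le_div_iff₀ (pow_pos (by linarith) 2)]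
        calc ‖A ζ‖ * ‖f ζ‖ * (1 - ‖ζ‖) ^ 2
            ≤ ‖A ζ‖ * ((‖f 0‖ + b) * (1 - Real.log (1 - ‖ζ‖))) * (1 - ‖ζ‖) ^ 2 := by gcongr
          _ = ‖A ζ‖ * (1 - ‖ζ‖) ^ 2 * (1 - Real.log (1 - ‖ζ‖)) * (‖f 0‖ + b) := by ring
          _ ≤ 1 / 2 * (‖f 0‖ + b) := by gcongr
          _ = c := by rw [hc]; ring)
    have h4 : b ≤ ‖deriv f 0‖ + c := by
      have h5 := mul_le_mul_of_nonneg_left key (by linarith : 0 ≤ 1 - ‖z₀‖)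
      have h6 : (1 - ‖z₀‖) * (‖deriv f 0‖ + (c / (1 - ‖z₀‖) - c / (1 - 0))) =
          (1 - ‖z₀‖) * ‖deriv f 0‖ + ‖z₀‖ * c := by
        have : 1 - ‖z₀‖ ≠ 0 := by linarith
        field_simp
        ring
      rw [← hb, h6] at h5
      nlinarith [norm_nonneg z₀, norm_nonneg (deriv f 0)]
    linarith [hle z le_rfl]
  refine ⟨2 * ‖deriv f 0‖ + ‖f 0‖, ‖f 0‖ + (2 * ‖deriv f 0‖ + ‖f 0‖), by positivity,
    by positivity, fun z hz => ⟨bloch z hz, growth _ (by positivity) z hz fun ζ hζ => bloch ζ ?_⟩⟩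
  exact mem_ball_zero_iff.2 (hζ.trans_lt (mem_ball_zero_iff.1 hz))

/-! ### The bounded correction term -/

/-- `∂∂̄((1 - |z|²)² |g|²)` dominates `|g|²` near the boundary, up to `(1 - |z|²)² |g'|²`. -/
lemma exists_hasDDbar_weighted_normSq {g : ℂ → ℂ} (hg : DifferentiableOn ℂ g (ball 0 1)) :
    ∃ (p : ℂ → ℂ) (q : ℂ → ℝ),
      HasDDbar (fun z => (1 - ‖z‖ ^ 2) * (1 - ‖z‖ ^ 2) * ‖g z‖ ^ 2) p q ∧
      ∀ z ∈ ball (0 : ℂ) 1, (1 - 4 * (1 - ‖z‖ ^ 2)) * ‖g z‖ ^ 2 -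
        3 * ((1 - ‖z‖ ^ 2) ^ 2 * ‖deriv g z‖ ^ 2) ≤ q z := by
  refine ⟨_, _, (hasDDbar_one_sub_norm_sq.mul hasDDbar_one_sub_norm_sq).mul (.normSq hg),
    fun z hz => ?_⟩
  have hz1 := (mem_ball_zero_iff.1 hz).le
  have hρ := (one_sub_norm_sq_pos hz).le
  have e : (-(starRingEnd ℂ) z * (starRingEnd ℂ) (-(starRingEnd ℂ) z)).re = ‖z‖ ^ 2 := by
    rw [Complex.mul_conj', norm_neg, RCLike.norm_conj, ← Complex.ofReal_pow, Complex.ofReal_re]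
  rw [e]
  set ρ := 1 - ‖z‖ ^ 2 with hρd
  have hz2 : ‖z‖ ^ 2 = 1 - ρ := by rw [hρd]; ring
  set X := ((ρ : ℂ) * -(starRingEnd ℂ) z + (ρ : ℂ) * -(starRingEnd ℂ) z) *
    (starRingEnd ℂ) (deriv g z * (starRingEnd ℂ) (g z)) with hX
  have hXn : ‖X‖ = 2 * ρ * ‖z‖ * (‖deriv g z‖ * ‖g z‖) := by
    rw [hX, ← two_mul]
    simp only [norm_mul, norm_neg, RCLike.norm_conj, Complex.norm_ofNat, Complex.norm_real,
      Real.norm_of_nonneg hρ]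
    ring
  have h1 := (abs_le.1 (Complex.abs_re_le_norm X)).1
  have h2 : ‖X‖ ≤ 2 * ρ * 1 * (‖deriv g z‖ * ‖g z‖) := by rw [hXn]; gcongr
  rw [hz2]
  nlinarith [sq_nonneg (‖g z‖ - 2 * ρ * ‖deriv g z‖)]

/-- If `0 ≤ V ≤ ε` and `V` is superharmonic, then the concave function `V - N V²` of `V` makes
`|f|² (V - N V²)` almost superharmonic where `-∂∂̄V` is large: the term `-2N |∂V|²` from the second
derivative absorbs the mixed term `2 Re (f' f̄ ∂̄V)`. -/
lemma exists_hasDDbar_normSq_mul {f : ℂ → ℂ} (hf : DifferentiableOn ℂ f (ball 0 1))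
    {V : ℂ → ℝ} {pV : ℂ → ℂ} {qV : ℂ → ℝ} (hV : HasDDbar V pV qV) {ε N : ℝ} (hN : 0 < N)
    (hεN : 4 * N * ε ≤ 1) (hV0 : ∀ z ∈ ball (0 : ℂ) 1, 0 ≤ V z)
    (hVε : ∀ z ∈ ball (0 : ℂ) 1, V z ≤ ε) (hq : ∀ z ∈ ball (0 : ℂ) 1, qV z ≤ 0) :
    ∃ (p : ℂ → ℂ) (q : ℂ → ℝ),
      HasDDbar (fun z => ‖f z‖ ^ 2 * (V z + -N * (V z * V z))) p q ∧
      ∀ z ∈ ball (0 : ℂ) 1,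
        q z ≤ (ε + 1 / (2 * N)) * ‖deriv f z‖ ^ 2 + ‖f z‖ ^ 2 * (qV z / 2) := by
  refine ⟨_, _, (HasDDbar.normSq hf).mul (hV.add ((hV.mul hV).const_mul (-N))), fun z hz => ?_⟩
  have v0 := hV0 z hz
  have vε := hVε z hz
  have q0 := hq z hz
  have e : (pV z * (starRingEnd ℂ) (pV z)).re = ‖pV z‖ ^ 2 := by
    rw [Complex.mul_conj', ← Complex.ofReal_pow, Complex.ofReal_re]
  rw [e]
  have hNV : N * V z ≤ 1 / 4 := by nlinarith
  have hNV0 : 0 ≤ N * V z := by positivity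
  set X := deriv f z * (starRingEnd ℂ) (f z) *
    (starRingEnd ℂ) (pV z + ((-N : ℝ) : ℂ) * ((V z : ℂ) * pV z + (V z : ℂ) * pV z)) with hX
  have hXn : ‖X‖ = ‖deriv f z‖ * ‖f z‖ * ((1 - 2 * (N * V z)) * ‖pV z‖) := by
    have : pV z + ((-N : ℝ) : ℂ) * ((V z : ℂ) * pV z + (V z : ℂ) * pV z) =
        ((1 - 2 * (N * V z) : ℝ) : ℂ) * pV z := by push_cast; ring
    rw [hX, this]
    simp only [norm_mul, RCLike.norm_conj, Complex.norm_real]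
    rw [Real.norm_of_nonneg (by linarith)]
  have h1 := (abs_le.1 (Complex.abs_re_le_norm X)).2
  have h2 : ‖X‖ ≤ ‖deriv f z‖ * ‖f z‖ * (1 * ‖pV z‖) := by
    rw [hXn]
    gcongr
    linarith
  have h3 : 2 * (‖deriv f z‖ * ‖f z‖ * (1 * ‖pV z‖)) ≤
      1 / (2 * N) * ‖deriv f z‖ ^ 2 + 2 * N * (‖f z‖ ^ 2 * ‖pV z‖ ^ 2) := by
    have h4 : 0 ≤ 1 / (2 * N) * (‖deriv f z‖ - 2 * N * (‖f z‖ * ‖pV z‖)) ^ 2 := by positivity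
    have h5 : 1 / (2 * N) * (‖deriv f z‖ - 2 * N * (‖f z‖ * ‖pV z‖)) ^ 2 =
        1 / (2 * N) * ‖deriv f z‖ ^ 2 + 2 * N * (‖f z‖ ^ 2 * ‖pV z‖ ^ 2) -
          2 * (‖deriv f z‖ * ‖f z‖ * (1 * ‖pV z‖)) := by
      field_simp
      ring
    linarith
  have h6 : (V z + -N * (V z * V z)) * ‖deriv f z‖ ^ 2 ≤ ε * ‖deriv f z‖ ^ 2 := by
    gcongr
    nlinarith
  have h7 : ‖f z‖ ^ 2 * ((1 - 2 * (N * V z)) * qV z) ≤ ‖f z‖ ^ 2 * (qV z / 2) := by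
    gcongr
    nlinarith
  linarith

/-- For a Bloch solution of `f'' + A f = 0`, a bounded function `b` with `∂∂̄b ≤ -|f'|²`, so that
all the functions `|f - c|² + b` are superharmonic. -/
lemma exists_bounded_hasDDbar_le {A f : ℂ → ℂ} {ε : ℝ} (hε : 0 ≤ ε) (hε1 : 960000 * ε ≤ 1)
    (hA : DifferentiableOn ℂ A (ball 0 1)) (hlmoa : lmoaSecondNormSq A ≤ ENNReal.ofReal ε)
    (hf : DifferentiableOn ℂ f (ball 0 1))
    (hode : ∀ z ∈ ball (0 : ℂ) 1, deriv (deriv f) z + A z * f z = 0) :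
    ∃ (b : ℂ → ℝ) (p : ℂ → ℂ) (q : ℂ → ℝ) (C : ℝ), HasDDbar b p q ∧
      (∀ z ∈ ball (0 : ℂ) 1, |b z| ≤ C) ∧ ∀ z ∈ ball (0 : ℂ) 1, q z ≤ -‖deriv f z‖ ^ 2 := by
  have hw := integrable_coeffWeight hA hlmoa
  have hV0 : ∀ z ∈ ball (0 : ℂ) 1, 0 ≤ coeffPotential A z := fun z hz => coeffPotential_nonneg hz
  have hVε : ∀ z ∈ ball (0 : ℂ) 1, coeffPotential A z ≤ ε := fun z hz =>
    coeffPotential_le hε hA hlmoa hz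
  have hVlog : ∀ z ∈ ball (0 : ℂ) 1, (1 - Real.log (1 - ‖z‖)) ^ 2 * coeffPotential A z ≤ ε :=
    fun z hz => log_sq_mul_coeffPotential_le hε hA hlmoa hz
  obtain ⟨β, K, hβ, hK, hbloch⟩ := exists_bloch_bound hf hode fun z hz => by
    have h1 := sq_norm_mul_le_coeffPotential hA hw hz
    have h2 := hVlog z hz
    have h3 := one_le_one_sub_log hz
    set l := 1 - Real.log (1 - ‖z‖)
    refine le_of_abs_le (abs_le_of_sq_le_sq ?_ (by norm_num))
    calc (‖A z‖ * (1 - ‖z‖) ^ 2 * l) ^ 2 = l ^ 2 * (‖A z‖ ^ 2 * (1 - ‖z‖) ^ 4) := by ring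
      _ ≤ l ^ 2 * (200 * coeffPotential A z) := by gcongr
      _ ≤ (1 / 2) ^ 2 := by linarith
  obtain ⟨pV, qV, hV, hqV⟩ := exists_hasDDbar_potential hw
  have hqA : ∀ z ∈ ball (0 : ℂ) 1,
      qV z ≤ -((1 - ‖z‖ ^ 2) ^ 2 * ‖A z‖ ^ 2 / 10000) := fun z hz => by
    have := sq_norm_mul_le_integral hA hw hz
    rw [hqV z hz]
    linarith
  have hf' : DifferentiableOn ℂ (deriv f) (ball 0 1) := hf.deriv isOpen_ball
  obtain ⟨p₁, q₁, h₁, hq₁⟩ := exists_hasDDbar_weighted_normSq hf'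
  -- the factor `12` from `h₁` times `10000 * 2` from `hqA` and `hq₂` gives the weight `240000`;
  -- with `N` of the same size and `ε ≤ 1 / (4 N)`, the new multiple of `|f'|²` is at most one
  obtain ⟨p₂, q₂, h₂, hq₂⟩ := exists_hasDDbar_normSq_mul hf (V := coeffPotential A) hV
    (N := 240000) (by norm_num) (by linarith) hV0 hVε
    (fun z hz => (hqA z hz).trans (neg_nonpos.2 (by positivity)))
  have h₃ := HasDDbar.normSq (differentiableOn_id (𝕜 := ℂ) (s := ball 0 1))
  refine ⟨_, _, _, 16 * β ^ 2 + 4096 * β ^ 2 + 240000 * (K ^ 2 * ε),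
    ((h₁.const_mul (-4)).add (h₂.const_mul 240000)).add (h₃.const_mul (-(4096 * β ^ 2))),
    fun z hz => ?_, fun z hz => ?_⟩
  · obtain ⟨hb1, hb2⟩ := hbloch z hz
    have hz1 := mem_ball_zero_iff.1 hz
    have hz0 := norm_nonneg z
    have v0 := hV0 z hz
    have vε := hVε z hz
    have vl := hVlog z hz
    have b1 : (1 - ‖z‖ ^ 2) * (1 - ‖z‖ ^ 2) * ‖deriv f z‖ ^ 2 ≤ 4 * β ^ 2 := by
      have e : (1 - ‖z‖ ^ 2) * (1 - ‖z‖ ^ 2) * ‖deriv f z‖ ^ 2 =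
          (1 + ‖z‖) ^ 2 * ((1 - ‖z‖) * ‖deriv f z‖) ^ 2 := by ring
      rw [e]
      have : 0 ≤ (1 - ‖z‖) * ‖deriv f z‖ := mul_nonneg (by linarith) (norm_nonneg _)
      gcongr
      nlinarith
    have b1' : 0 ≤ (1 - ‖z‖ ^ 2) * (1 - ‖z‖ ^ 2) * ‖deriv f z‖ ^ 2 :=
      mul_nonneg (mul_self_nonneg _) (by positivity)
    have hh0 : 0 ≤ coeffPotential A z + -240000 * (coeffPotential A z * coeffPotential A z) := by
      nlinarith
    have hh1 : coeffPotential A z + -240000 * (coeffPotential A z * coeffPotential A z) ≤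
        coeffPotential A z := by nlinarith
    have b2 : ‖f z‖ ^ 2 * (coeffPotential A z +
        -240000 * (coeffPotential A z * coeffPotential A z)) ≤ K ^ 2 * ε := by
      calc _ ≤ (K * (1 - Real.log (1 - ‖z‖))) ^ 2 * coeffPotential A z := by gcongr
        _ = K ^ 2 * ((1 - Real.log (1 - ‖z‖)) ^ 2 * coeffPotential A z) := by ring
        _ ≤ _ := by gcongr
    have b2' : 0 ≤ ‖f z‖ ^ 2 * (coeffPotential A z +
        -240000 * (coeffPotential A z * coeffPotential A z)) := mul_nonneg (by positivity) hh0
    have b3 : 4096 * β ^ 2 * ‖id z‖ ^ 2 ≤ 4096 * β ^ 2 * 1 := by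
      gcongr
      simp only [id]
      nlinarith
    have b3' : 0 ≤ 4096 * β ^ 2 * ‖id z‖ ^ 2 := by positivity
    have b4 : 0 ≤ K ^ 2 * ε := by positivity
    have b5 : 0 ≤ β ^ 2 := by positivity
    rw [abs_le]
    constructor <;> linarith
  · obtain ⟨hb1, -⟩ := hbloch z hz
    have k1 := hq₁ z hz
    have k2 := hq₂ z hz
    have kA := hqA z hz
    have hz1 := mem_ball_zero_iff.1 hz
    have hz0 := norm_nonneg z
    have hρ := (one_sub_norm_sq_pos hz).le
    have e2 : ‖deriv (deriv f) z‖ ^ 2 = ‖A z‖ ^ 2 * ‖f z‖ ^ 2 := by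
      rw [eq_neg_of_add_eq_zero_left (hode z hz), norm_neg, norm_mul, mul_pow]
    have e3 : ‖deriv id z‖ ^ 2 = 1 := by simp
    rw [e2] at k1
    rw [e3]
    -- away from the boundary the derivative is bounded, by the Bloch property
    have k3 : 16 * (1 - ‖z‖ ^ 2) * ‖deriv f z‖ ^ 2 ≤ 2 * ‖deriv f z‖ ^ 2 + 4096 * β ^ 2 := by
      rcases le_total (1 - ‖z‖ ^ 2) (1 / 8) with h | h
      · nlinarith [sq_nonneg ‖deriv f z‖, sq_nonneg β]
      · have h1 : 1 / 16 ≤ 1 - ‖z‖ := by nlinarith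
        have h2 : ‖deriv f z‖ ≤ 16 * β := by nlinarith [norm_nonneg (deriv f z)]
        have h3 : ‖deriv f z‖ ^ 2 ≤ (16 * β) ^ 2 := by gcongr
        nlinarith [sq_nonneg ‖deriv f z‖, sq_nonneg ‖z‖]
    have k4 := mul_le_mul_of_nonneg_left kA (by positivity : 0 ≤ 120000 * ‖f z‖ ^ 2)
    have k5 : 240000 * ((ε + 1 / (2 * 240000)) * ‖deriv f z‖ ^ 2) ≤ 1 * ‖deriv f z‖ ^ 2 := by
      rw [← mul_assoc]
      gcongr
      linarith
    linarith

/-! ### Bounded mean oscillation -/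

/-- A bounded function `b` with `∂∂̄b ≤ -|f'|²` bounds the mean oscillation of `f`, by the super-mean
value inequality for `|f - f(a)|² + b` transported by the automorphism `φ_a`. -/
lemma memBMOA_of_hasDDbar_le {f : ℂ → ℂ} (hf : DifferentiableOn ℂ f (ball 0 1)) {b : ℂ → ℝ}
    {p : ℂ → ℂ} {q : ℂ → ℝ} {C : ℝ} (hb : HasDDbar b p q) (hC : ∀ z ∈ ball (0 : ℂ) 1, |b z| ≤ C)
    (hq : ∀ z ∈ ball (0 : ℂ) 1, q z ≤ -‖deriv f z‖ ^ 2) : MemBMOA f := by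
  refine ⟨hf, lt_of_le_of_lt (iSup₂_le fun a ha => iSup₂_le fun r hr => ?_)
    (ENNReal.ofReal_lt_top (r := 2 * C))⟩
  obtain ⟨hr0, hr1⟩ := hr
  have hm := mapsTo_discAut ha
  have hφ := differentiableOn_discAut ha
  have h1 := HasDDbar.normSq (hf.sub_const (f a))
  have h2 := ((h1.add hb).comp hφ hm).integral_circle_le (fun z hz => by
    have := hq _ (hm hz)
    refine mul_nonpos_of_nonpos_of_nonneg ?_ (by positivity)
    rw [deriv_sub_const_fun]
    linarith) hr0 hr1
  have hmem : ∀ θ, circleMap 0 r θ ∈ ball (0 : ℂ) 1 := fun θ => by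
    simpa [abs_of_nonneg hr0] using hr1
  have hcirc : Continuous (circleMap 0 r) := continuous_circleMap 0 r
  have c1 : Continuous fun θ => ‖f (discAut a (circleMap 0 r θ)) - f a‖ ^ 2 :=
    h1.continuousOn.comp_continuous (hφ.continuousOn.comp_continuous hcirc hmem)
      fun θ => hm (hmem θ)
  have c2 : Continuous fun θ => b (discAut a (circleMap 0 r θ)) :=
    hb.continuousOn.comp_continuous (hφ.continuousOn.comp_continuous hcirc hmem)
      fun θ => hm (hmem θ)
  have h0 : discAut a 0 = a := by simp [discAut]
  rw [intervalIntegral.integral_add (c1.intervalIntegrable _ _) (c2.intervalIntegrable _ _), h0,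
    sub_self, norm_zero] at h2
  have h3 : ∫ θ in (0 : ℝ)..2 * Real.pi, -C ≤
      ∫ θ in (0 : ℝ)..2 * Real.pi, b (discAut a (circleMap 0 r θ)) :=
    intervalIntegral.integral_mono_on (by positivity) intervalIntegrable_const
      (c2.intervalIntegrable _ _) fun θ _ => (abs_le.1 (hC _ (hm (hmem θ)))).1
  rw [intervalIntegral.integral_const, smul_eq_mul, sub_zero] at h3
  have h4 := (abs_le.1 (hC a ha)).2
  have h5 : ∫ θ in (0 : ℝ)..2 * Real.pi, ‖f (discAut a (circleMap 0 r θ)) - f a‖ ^ 2 ≤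
      2 * Real.pi * (2 * C) := by nlinarith [Real.pi_pos]
  rw [intervalIntegral.integral_of_le (by positivity)] at h5
  have e : ∀ θ : ℝ, (r : ℂ) * Complex.exp ((θ : ℂ) * Complex.I) = circleMap 0 r θ := fun θ => by
    simp [circleMap]
  simp only [e]
  have ci : IntegrableOn (fun θ => ‖f (discAut a (circleMap 0 r θ)) - f a‖ ^ 2)
      (Set.Ioc 0 (2 * Real.pi)) := (c1.integrableOn_Icc).mono_set Set.Ioc_subset_Icc_self
  rw [← ofReal_integral_eq_lintegral_ofReal ci (.of_forall fun θ => by positivity)]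
  calc (ENNReal.ofReal (2 * Real.pi))⁻¹ * ENNReal.ofReal _
      ≤ (ENNReal.ofReal (2 * Real.pi))⁻¹ * ENNReal.ofReal (2 * Real.pi * (2 * C)) := by
        gcongr
    _ = ENNReal.ofReal (2 * C) := by
        rw [ENNReal.ofReal_mul (p := 2 * Real.pi) (by positivity), ← mul_assoc,
          ENNReal.inv_mul_cancel (by simp [Real.pi_pos]) ENNReal.ofReal_ne_top, one_mul]

theorem theorem3 :
    ∃ ε : ℝ, 0 < ε ∧
      ∀ A : ℂ → ℂ, DifferentiableOn ℂ A (ball (0 : ℂ) 1) →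
        lmoaSecondNormSq A ≤ ENNReal.ofReal ε →
        ∀ f : ℂ → ℂ, DifferentiableOn ℂ f (ball (0 : ℂ) 1) →
          (∀ z ∈ ball (0 : ℂ) 1, deriv (deriv f) z + A z * f z = 0) →
          MemBMOA f := by
  refine ⟨1 / 960000, by norm_num, fun A hA hlmoa f hf hode => ?_⟩
  obtain ⟨b, p, q, C, hb, hC, hq⟩ :=
    exists_bounded_hasDDbar_le (by norm_num) (by norm_num) hA hlmoa hf hode
  exact memBMOA_of_hasDDbar_le hf hb hC hq
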